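/- Let $d,p\ge 1$ be integers, let $\Delta$ be the discrete Laplacian $(\Delta u)_n=\sum_{|k-n|=1}(u_k-u_n)$ on $\ell^2(\mathbb{Z}^d)$ (complex sequences), and let $\gamma_p=\binom{1+2p}{1+p}$. Let $\Omega\in\mathbb{R}\setminus[-4d,0]$, and let $\mathcal{A}\in\ell^2(\mathbb{Z}^d)$ be a real solution of the stationary dNLS equation $\Omega\mathcal{A}+\gamma_p|\mathcal{A}|^{2p}\mathcal{A}=\Delta\mathcal{A}$ such that $J_\Omega=\Omega+(1+2p)\gamma_p|\mathcal{A}|^{2p}-\Delta$ has trivial null space in $\ell^2(\mathbb{Z}^d)$. On $\ell^2(\mathbb{Z}^d)\times\ell^2(\mathbb{Z}^d)$ let $$\mathcal{L}=\begin{bmatrix}0&-(\Omega-\Delta+\gamma_p\mathcal{A}^{2p})\\ \Omega-\Delta+\gamma_p(1+2p)\mathcal{A}^{2p}&0\end{bmatrix}.$$ Let $\Lambda\in i\mathbb{R}\setminus\{0\}$ be such that $2\Lambda$ is a simple (algebraic multiplicity one) isolated eigenvalue of $\mathcal{L}$ with $2\Lambda\notin i[\Omega,\Omega+4d]\cup -i[\Omega,\Omega+4d]$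 (the continuous spectrum of $\mathcal{L}$), and let $(b_+,b_-)\ne 0$ be an eigenvector, $\mathcal{L}(b_+,b_-)^T=2\Lambda(b_+,b_-)^T$. Let $\ell^{2,2}$ be the space of sequences $B=\{B^{(m)}\}_{m\in\mathbb{Z}}$ in $\ell^2(\mathbb{Z}^d)$ with $\sum_m(1+m^2)^2\|B^{(m)}\|^2<\infty$. A *breather branch* consists of $\epsilon_1>0$, $C_1\in\mathbb{R}$ and real-analytic maps $\omega:(0,\epsilon_1)\to\mathbb{R}$, $A:(0,\epsilon_1)\to\ell^{2,2}$, with $A^{(m)}$ real and $A^{(-m)}=A^{(m)}$, such that, with $U(\tau)=\sum_m A^{(m)}e^{im\tau}$ and componentwise powers, for all $\epsilon\in(0,\epsilon_1)$ and $m\in\mathbb{Z}$, $$(1-m^2\omega^2)A^{(m)}+\frac{\epsilon}{2\pi}\int_{-\pi}^{\pi}U^{1+2p}(\tau)e^{-im\tau}\,d\tau=\epsilon\Delta A^{(m)},$$ $$\left|\omega-1+\tfrac12\epsilon\Omega\right|\le C_1\epsilon^2,\qquad \|A^{(0)}\|+\|A^{(1)}-\mathcal{A}\|+\sum_{m\ge2}\|A^{(m)}\|\le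 C_1\epsilon .$$ Then a breather branch exists. Moreover, for every breather branch there are $\epsilon_0\in(0,\epsilon_1]$, $C_0>0$, $\delta>0$ with $C_0\epsilon_0\le\delta$ and real-analytic maps $\lambda:(0,\epsilon_0)\to\mathbb{C}$, $B:(0,\epsilon_0)\to\ell^{2,2}$ such that, for every $\epsilon\in(0,\epsilon_0)$, $\lambda(\epsilon)\in i\mathbb{R}$ and $B(\epsilon)\neq0$; with $\lambda=\lambda(\epsilon)$, $B=B(\epsilon)$ and $W(\tau)=\sum_m B^{(m)}e^{im\tau}$, the linearized dKG spectral problem $$\left[1+(\lambda+im\omega)^2\right]B^{(m)}+\frac{\epsilon(1+2p)}{2\pi}\int_{-\pi}^{\pi}U^{2p}(\tau)W(\tau)e^{-im\tau}\,d\tau=\epsilon\Delta B^{(m)},\qquad m\in\mathbb{Z},$$ holds; and $$|\lambda(\epsilon)-\epsilon\Lambda|\le C_0\epsilon^2,\qquad \|B^{(1)}-b_+-ib_-\|+\|B^{(-1)}-b_++ib_-\|\le C_0\epsilon,\qquad \|B^{(0)}\|+\sum_{|m|\ge2}\|B^{(m)}\|\le C_0\epsilon .$$ The branch is unique in the following sense: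 for every $\epsilon\in(0,\epsilon_0)$, if $\mu\in\mathbb{C}$ with $|\mu-\epsilon\Lambda|<\delta\epsilon$ and $0\ne B'\in\ell^{2,2}$ solve the same spectral problem, then $\mu=\lambda(\epsilon)$ and $B'$ is a scalar multiple of $B(\epsilon)$. -/

import Mathlib

namespace KleinGordon

open Complex

noncomputable section

/-- The Hilbert space `ℓ²(ℤ^d)` of complex square-summable sequences on the cubic lattice. -/
abbrev Latt (d : ℕ) : Type := lp (fun _ : Fin d → ℤ => ℂ) 2

theorem memlp_shift {d : ℕ} (v : Fin d → ℤ) (u : Latt d) :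
    Memℓp (fun n : Fin d → ℤ => u (n + v)) 2 := by
  apply memℓp_gen
  exact (Equiv.addRight v).summable_iff.mpr ((lp.memℓp u).summable (by norm_num))

/-- The translation `(shift v u)_n = u_{n+v}` on `ℓ²(ℤ^d)`. -/
def shift {d : ℕ} (v : Fin d → ℤ) : Latt d →L[ℂ] Latt d :=
  LinearMap.mkContinuous
    { toFun := fun u => ⟨fun n => u (n + v), memlp_shift v u⟩
      map_add' := fun _ _ => rfl
      map_smul' := fun _ _ => rfl }
    1 (by
      intro u
      rw [one_mul]
      apply lp.norm_le_of_tsum_le (by norm_num) (norm_nonneg u)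
      rw [lp.norm_rpow_eq_tsum (by norm_num) u]
      exact ((Equiv.addRight v).tsum_eq
        (fun n => ‖u n‖ ^ (2 : ENNReal).toReal)).le)

/-- The discrete Laplacian `(Δ u)_n = ∑_{|k-n|=1} (u_k - u_n)` on `ℓ²(ℤ^d)`. -/
def lap (d : ℕ) : Latt d →L[ℂ] Latt d :=
  ∑ j : Fin d, (shift (Pi.single j 1) + shift (-Pi.single j 1)
    - (2 : ℂ) • ContinuousLinearMap.id ℂ (Latt d))

theorem norm_pow_mul_le {d : ℕ} (a u : Latt d) (k : ℕ) (n : Fin d → ℤ) :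
    ‖((‖a n‖ : ℂ) ^ k) * u n‖ ≤ ‖((‖a‖ : ℂ) ^ k • u) n‖ := by
  rw [lp.coeFn_smul, Pi.smul_apply, smul_eq_mul, norm_mul, norm_mul, norm_pow, norm_pow,
    norm_real, norm_real, norm_norm, norm_norm]
  gcongr
  exact lp.norm_apply_le_norm (by norm_num) a n

theorem memlp_mulAbsPow {d : ℕ} (a u : Latt d) (k : ℕ) :
    Memℓp (fun n : Fin d → ℤ => ((‖a n‖ : ℂ) ^ k) * u n) 2 :=
  (lp.memℓp ((‖a‖ : ℂ) ^ k • u)).mono' (norm_pow_mul_le a u k)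

/-- The multiplication operator `u ↦ |a|^k u` on `ℓ²(ℤ^d)`. -/
def mulAbsPow {d : ℕ} (a : Latt d) (k : ℕ) : Latt d →L[ℂ] Latt d :=
  LinearMap.mkContinuous
    { toFun := fun u => ⟨fun n => ((‖a n‖ : ℂ) ^ k) * u n, memlp_mulAbsPow a u k⟩
      map_add' := fun u w => by
        ext n
        exact mul_add _ (u n) (w n)
      map_smul' := fun c u => by
        ext n
        exact mul_left_comm _ c (u n) }
    (‖a‖ ^ k) (by
      intro u
      have h : ‖((‖a‖ : ℂ) ^ k • u)‖ = ‖a‖ ^ k * ‖u‖ := by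
        rw [norm_smul, norm_pow, norm_real, norm_norm]
      rw [← h]
      exact lp.norm_mono (by norm_num) (norm_pow_mul_le a u k))

/-- The coefficient `γ_p`. -/
def gam (p : ℕ) : ℝ := ((1 + 2 * p).choose (1 + p) : ℝ)

/-- The bounded operator `Ω - Δ + c γ_p |a|^{2p}` on `ℓ²(ℤ^d)`. -/
def schr {d : ℕ} (p : ℕ) (Ω c : ℝ) (a : Latt d) : Latt d →L[ℂ] Latt d :=
  (Ω : ℂ) • ContinuousLinearMap.id ℂ (Latt d) - lap d
    + ((c * gam p : ℝ) : ℂ) • mulAbsPow a (2 * p)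

/-- `a` is a real solution in `ℓ²(ℤ^d)` of the stationary dNLS equation
`Ω a + γ_p |a|^{2p} a = Δ a`. -/
def IsSoliton {d : ℕ} (p : ℕ) (Ω : ℝ) (a : Latt d) : Prop :=
  (∀ n, (a n).im = 0) ∧
    (Ω : ℂ) • a + (gam p : ℂ) • mulAbsPow a (2 * p) a = lap d a

/-- The Jacobian operator `J_Ω = Ω + (1+2p) γ_p |a|^{2p} - Δ` of the stationary dNLS equation. -/
def jac {d : ℕ} (p : ℕ) (Ω : ℝ) (a : Latt d) : Latt d →L[ℂ] Latt d :=
  schr p Ω (1 + 2 * p) a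

/-- The linearised dNLS operator
`(b₊, b₋) ↦ (-(Ω - Δ + γ_p a^{2p}) b₋, (Ω - Δ + γ_p (1+2p) a^{2p}) b₊)`
on `ℓ²(ℤ^d) × ℓ²(ℤ^d)`. -/
def linNLS {d : ℕ} (p : ℕ) (Ω : ℝ) (a : Latt d) :
    (Latt d × Latt d) →L[ℂ] (Latt d × Latt d) :=
  (-((schr p Ω 1 a).comp (ContinuousLinearMap.snd ℂ (Latt d) (Latt d)))).prod
    ((jac p Ω a).comp (ContinuousLinearMap.fst ℂ (Latt d) (Latt d)))

/-- The continuous spectrum `i[Ω, Ω+4d] ∪ -i[Ω, Ω+4d]` of the linearised dNLS operator. -/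
def contSpec (d : ℕ) (Ω : ℝ) : Set ℂ :=
  {z | ∃ s ∈ Set.Icc Ω (Ω + 4 * d), z = I * s ∨ z = -(I * s)}

/-- `z` is an isolated point of the spectrum of `T` and an eigenvalue of algebraic
multiplicity one. -/
structure IsSimpleIsolatedEigenvalue {F : Type*} [NormedAddCommGroup F] [NormedSpace ℂ F]
    (T : F →L[ℂ] F) (z : ℂ) : Prop where
  isolated : ∃ r > 0, ∀ w ∈ spectrum ℂ T, ‖w - z‖ < r → w = z
  simple : Module.finrank ℂ (Module.End.maxGenEigenspace (T : F →ₗ[ℂ] F) z) = 1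

/-- The weighted sequence `m ↦ (1 + m²) B^{(m)}`; the norm of `B` in `ℓ^{2,2}(ℤ; ℓ²(ℤ^d))` is
the `ℓ²(ℤ; ℓ²(ℤ^d))` norm of this sequence. -/
def weighted {d : ℕ} (B : ℤ → Latt d) : ℤ → Latt d :=
  fun m => (1 + (m : ℂ) ^ 2) • B m

/-- Membership in `ℓ^{2,2}(ℤ; ℓ²(ℤ^d))`. -/
def MemL22 {d : ℕ} (B : ℤ → Latt d) : Prop := Memℓp (weighted B) 2

/-- On the set `s`, `ε ↦ B ε` is a real-analytic map into `ℓ^{2,2}(ℤ; ℓ²(ℤ^d))`. The latter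
space is identified isometrically with `ℓ²(ℤ; ℓ²(ℤ^d))` by means of the weights. -/
def AnalyticL22On {d : ℕ} (B : ℝ → ℤ → Latt d) (s : Set ℝ) : Prop :=
  ∃ F : ℝ → lp (fun _ : ℤ => Latt d) 2,
    AnalyticOnNhd ℝ F s ∧ ∀ ε ∈ s, ∀ m, F ε m = weighted (B ε) m

/-- The component at the site `n` of the Fourier series `∑_{m ∈ ℤ} B^{(m)} e^{imτ}`. -/
def fourierSum {d : ℕ} (B : ℤ → Latt d) (n : Fin d → ℤ) (τ : ℝ) : ℂ :=
  ∑' m : ℤ, B m n * exp (I * m * τ)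

/-- The breather equation in Fourier coefficients, for coefficients `A ∈ ℓ^{2,2}(ℤ; ℓ²(ℤ^d))`
that are real and even in `m`. -/
structure IsBreather {d : ℕ} (p : ℕ) (ε ω : ℝ) (A : ℤ → Latt d) : Prop where
  mem : MemL22 A
  real : ∀ m n, (A m n).im = 0
  even : ∀ m, A (-m) = A m
  eqn : ∀ (m : ℤ) (n : Fin d → ℤ),
    (1 - (m : ℂ) ^ 2 * (ω : ℂ) ^ 2) * A m n
      + (ε : ℂ) / (2 * Real.pi) *
        ∫ τ in (-Real.pi)..Real.pi, fourierSum A n τ ^ (1 + 2 * p) * exp (-(I * m * τ))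
      = ε * lap d (A m) n

/-- An analytic branch of fundamental breathers over `0 < ε < ε₁` that bifurcates from the
dNLS soliton `a`. -/
structure IsBreatherBranch {d : ℕ} (p : ℕ) (Ω : ℝ) (a : Latt d) (ε₁ C₁ : ℝ)
    (ω : ℝ → ℝ) (A : ℝ → ℤ → Latt d) : Prop where
  pos : 0 < ε₁
  analytic_freq : AnalyticOnNhd ℝ ω (Set.Ioo 0 ε₁)
  analytic_coeff : AnalyticL22On A (Set.Ioo 0 ε₁)
  breather : ∀ ε ∈ Set.Ioo 0 ε₁, IsBreather p ε (ω ε) (A ε)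
  bound_freq : ∀ ε ∈ Set.Ioo 0 ε₁, |ω ε - 1 + ε * Ω / 2| ≤ C₁ * ε ^ 2
  bound_coeff : ∀ ε ∈ Set.Ioo 0 ε₁,
    ‖A ε 0‖ + ‖A ε 1 - a‖ + ∑' m : ℕ, ‖A ε (m + 2)‖ ≤ C₁ * ε

/-- `(μ, B)` is an eigenvalue-eigenvector pair of the linearisation of the dKG equation at the
breather with frequency `ω` and Fourier coefficients `A`, written in Fourier coefficients. -/
structure IsEigenpair {d : ℕ} (p : ℕ) (ε ω : ℝ) (A : ℤ → Latt d) (μ : ℂ) (B : ℤ → Latt d) :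
    Prop where
  mem : MemL22 B
  ne_zero : B ≠ 0
  eqn : ∀ (m : ℤ) (n : Fin d → ℤ),
    (1 + (μ + I * m * ω) ^ 2) * B m n
      + (ε : ℂ) * (1 + 2 * p) / (2 * Real.pi) *
        ∫ τ in (-Real.pi)..Real.pi,
          fourierSum A n τ ^ (2 * p) * fourierSum B n τ * exp (-(I * m * τ))
      = ε * lap d (B m) n

end

end KleinGordon

/-! Put λ = εσ and divide the equations for the modes m = ±1, whose symbol is small, by ε. In terms
of the weighted sequence (1 + m²)B^{(m)} the spectral problem becomes `kgOp` applied to F equals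
zero, with a bounded operator that is jointly analytic in ε, ω, θ = (1 - ω²)/ε, σ and the potential,
and that is regular at the limit ε = 0, ω = 1, θ = Ω. In the limit the modes m ≠ ±1 satisfy (1 -
m²)B^{(m)} = 0, and the modes ±1 form a two-component problem `pairOp`, in which the potential (2a
cos τ)^{2p} enters through its Fourier coefficients 0 and ±2. The substitution z = (b₊ + ib₋, b₊ -
ib₋) turns that problem into (L - 2σ)b, where L is the linearised dNLS operator (`pairOp_polarize`).
Off the continuous spectrum it is an invertible operator plus a compact one, because multiplication
by an ℓ² sequence is compact. So bijectivity of the full limit operator, even after a compact change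
of the ±1 block, follows from injectivity on that block (`bijective_baseOp_add`).

Breathers come from the analytic implicit function theorem with θ frozen at Ω, that is ω = √(1 -
εΩ). On even sequences the linearisation is governed by J_Ω, but on odd ones its kernel contains a,
the trace of time translation. A compact correction that vanishes on even sequences removes this
kernel. Local uniqueness then forces the solution to be even and real, since reflection and
conjugation preserve the equation, and for even sequences the correction is absent.

Eigenvalues come from bordering (`exists_analytic_eigenpair`): adding a rank-one operator x ↦ ℓ(x)r
makes the limit operator invertible, because 2Λ is simple, and the kernel of the original operator
is then detected by one scalar analytic equation in σ with nonzero derivative. An arbitrary breather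
branch enters only through parameters that are O(ε) close to their limit
(`IsBreatherBranch.norm_branchParams_sub_le`). Since conjugation sends σ to -σ̄, uniqueness of the
eigenvalue near the imaginary number Λ makes it imaginary. -/

namespace KleinGordon

open Complex Filter Topology

noncomputable section

variable {d : ℕ}

/-! ### Bounded operators on sequences of Fourier modes, and convolution. -/

/-- The space `ℓ²(ℤ; ℓ²(ℤ^d))` of sequences of Fourier coefficients. -/
abbrev Modes (d : ℕ) : Type := lp (fun _ : ℤ => Latt d) 2

theorem Modes.ext' {F G : Modes d} (h : ∀ m n, F m n = G m n) : F = G :=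
  lp.ext (funext fun m => lp.ext (funext fun n => h m n))

theorem norm_mode_le (F : Modes d) (m : ℤ) : ‖F m‖ ≤ ‖F‖ :=
  lp.norm_apply_le_norm (by norm_num) F m

/-- Reindexing of the Fourier modes by a permutation of `ℤ`. -/
def reindex (e : ℤ ≃ ℤ) : Modes d →L[ℂ] Modes d :=
  LinearMap.mkContinuous
    { toFun := fun F => ⟨fun m => F (e m), by
        apply memℓp_gen
        exact e.summable_iff.mpr ((lp.memℓp F).summable (by norm_num))⟩
      map_add' := fun _ _ => rfl
      map_smul' := fun _ _ => rfl }
    1 (by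
      intro F
      rw [one_mul]
      apply lp.norm_le_of_tsum_le (by norm_num) (norm_nonneg F)
      rw [lp.norm_rpow_eq_tsum (by norm_num) F]
      exact (e.tsum_eq (fun m => ‖F m‖ ^ (2 : ENNReal).toReal)).le)

theorem norm_reindex_le (e : ℤ ≃ ℤ) (F : Modes d) : ‖reindex e F‖ ≤ ‖F‖ := by
  simpa using LinearMap.mkContinuous_norm_le _ zero_le_one _ |> fun h =>
    (reindex (d := d) e).le_of_opNorm_le h F

/-- Multiplication of the Fourier series by `e^{ikτ}`. -/
def modeShift (k : ℤ) : Modes d →L[ℂ] Modes d := reindex (Equiv.subRight k)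

@[simp]
theorem modeShift_apply (k : ℤ) (F : Modes d) (m : ℤ) : modeShift k F m = F (m - k) := rfl

theorem modeShift_mul (j k : ℤ) :
    (modeShift j * modeShift k : Modes d →L[ℂ] Modes d) = modeShift (j + k) := by
  ext1 F
  refine lp.ext (funext fun m => ?_)
  simp [sub_sub]

theorem modeShift_pow (k : ℤ) (j : ℕ) :
    (modeShift k ^ j : Modes d →L[ℂ] Modes d) = modeShift (j * k) := by
  induction j with
  | zero =>
    ext1 F
    refine lp.ext (funext fun m => ?_)
    simp
  | succ j ih =>
    rw [pow_succ, ih, modeShift_mul]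
    congr 1
    push_cast
    ring

theorem norm_mul_apply_le (u : Latt d) (n : Fin d → ℤ) :
    ‖ContinuousLinearMap.mul ℂ ℂ (u n)‖ ≤ ‖u‖ := by
  rw [ContinuousLinearMap.opNorm_mul_apply]
  exact lp.norm_apply_le_norm (by norm_num) u n

/-- Sitewise multiplication on `ℓ²(ℤ^d)`. -/
def siteMul : Latt d →L[ℂ] Latt d →L[ℂ] Latt d :=
  LinearMap.mkContinuous
    { toFun := fun u => lp.mapCLM 2 (fun n => ContinuousLinearMap.mul ℂ ℂ (u n)) (norm_nonneg u)
        (norm_mul_apply_le u)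
      map_add' := fun u v => by
        ext w n
        exact add_mul _ _ _
      map_smul' := fun c u => by
        ext w n
        exact mul_assoc _ _ _ }
    1 (fun u => by
      rw [one_mul]
      exact lp.norm_mapCLM_le 2 _ (norm_nonneg u) (norm_mul_apply_le u))

@[simp]
theorem siteMul_apply (u v : Latt d) (n : Fin d → ℤ) : siteMul u v n = u n * v n := rfl

theorem norm_siteMul_le (u : Latt d) : ‖siteMul u‖ ≤ ‖u‖ := by
  have h : ‖(siteMul : Latt d →L[ℂ] Latt d →L[ℂ] Latt d)‖ ≤ 1 :=
    LinearMap.mkContinuous_norm_le _ zero_le_one _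
  simpa using (siteMul : Latt d →L[ℂ] Latt d →L[ℂ] Latt d).le_of_opNorm_le h u

/-- The action of an operator on `ℓ²(ℤ^d)` on every Fourier coefficient. -/
def mapModes : (Latt d →L[ℂ] Latt d) →L[ℂ] (Modes d →L[ℂ] Modes d) :=
  LinearMap.mkContinuous
    { toFun := fun K => lp.mapCLM 2 (fun _ => K) (norm_nonneg K) (fun _ => le_rfl)
      map_add' := fun _ _ => rfl
      map_smul' := fun _ _ => rfl }
    1 (fun K => by
      rw [one_mul]
      exact lp.norm_mapCLM_le 2 _ (norm_nonneg K) (fun _ => le_rfl))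

theorem norm_mapModes_le (K : Latt d →L[ℂ] Latt d) : ‖mapModes K‖ ≤ ‖K‖ :=
  lp.norm_mapCLM_le 2 _ (norm_nonneg K) (fun _ => le_rfl)

@[simp]
theorem mapModes_apply (K : Latt d →L[ℂ] Latt d) (F : Modes d) (m : ℤ) :
    mapModes K F m = K (F m) := rfl

theorem mapModes_mul (K L : Latt d →L[ℂ] Latt d) : mapModes (K * L) = mapModes K * mapModes L := by
  ext1 F
  refine lp.ext (funext fun m => ?_)
  simp

theorem mapModes_pow (K : Latt d →L[ℂ] Latt d) (j : ℕ) : mapModes (K ^ j) = mapModes K ^ j := by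
  induction j with
  | zero =>
    ext1 F
    refine lp.ext (funext fun m => ?_)
    simp
  | succ j ih => rw [pow_succ, pow_succ, mapModes_mul, ih]

theorem modeShift_comm_mapModes (k : ℤ) (K : Latt d →L[ℂ] Latt d) :
    Commute (modeShift k) (mapModes K) := by
  ext1 F
  refine lp.ext (funext fun m => ?_)
  simp

/-- Multiplication of a Fourier series by `u e^{ikτ}`. -/
def mulMode (k : ℤ) : Latt d →L[ℂ] (Modes d →L[ℂ] Modes d) :=
  (ContinuousLinearMap.compL ℂ (Modes d) (Modes d) (Modes d) (modeShift k)).comp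
    (mapModes.comp siteMul)

theorem mulMode_eq (k : ℤ) (u : Latt d) : mulMode k u = modeShift k * mapModes (siteMul u) := rfl

@[simp]
theorem mulMode_apply (k : ℤ) (u : Latt d) (F : Modes d) (m : ℤ) :
    mulMode k u F m = siteMul u (F (m - k)) := rfl

theorem norm_mulMode_le (k : ℤ) : ‖(mulMode k : Latt d →L[ℂ] (Modes d →L[ℂ] Modes d))‖ ≤ 1 := by
  refine ContinuousLinearMap.opNorm_le_bound _ zero_le_one fun u => ?_
  refine ContinuousLinearMap.opNorm_le_bound _ (by positivity) fun F => ?_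
  refine (norm_reindex_le _ _).trans ?_
  have h : ‖mapModes (siteMul u)‖ ≤ ‖u‖ :=
    (norm_mapModes_le _).trans (norm_siteMul_le u)
  simpa using (mapModes (siteMul u)).le_of_opNorm_le h F

theorem mulMode_commute (j k : ℤ) (u v : Latt d) : Commute (mulMode j u) (mulMode k v) := by
  ext1 F
  refine Modes.ext' fun m n => ?_
  simp only [mul_apply_eq_comp, mulMode_apply, siteMul_apply]
  rw [sub_right_comm]
  ring

/-- The convolution in the Fourier index by an absolutely summable sequence. -/
def modeConv : lp (fun _ : ℤ => Latt d) 1 →L[ℂ] (Modes d →L[ℂ] Modes d) :=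
  (lp.tsumCLM ℂ ℤ (Modes d →L[ℂ] Modes d)).comp
    (lp.mapCLM 1 mulMode zero_le_one norm_mulMode_le)

theorem summable_norm_l1 (f : lp (fun _ : ℤ => Latt d) 1) : Summable fun k => ‖f k‖ := by
  simpa using (lp.memℓp f).summable (by norm_num)

theorem summable_norm_mulMode (f : lp (fun _ : ℤ => Latt d) 1) :
    Summable fun k => ‖mulMode k (f k)‖ :=
  (summable_norm_l1 f).of_nonneg_of_le (fun _ => norm_nonneg _) fun k => by
    simpa using (mulMode k).le_of_opNorm_le (norm_mulMode_le k) (f k)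

theorem modeConv_eq_tsum (f : lp (fun _ : ℤ => Latt d) 1) : modeConv f = ∑' k, mulMode k (f k) :=
  rfl

theorem norm_modeConv_le (f : lp (fun _ : ℤ => Latt d) 1) : ‖modeConv f‖ ≤ ∑' k, ‖f k‖ := by
  rw [modeConv_eq_tsum]
  refine (norm_tsum_le_tsum_norm (summable_norm_mulMode f)).trans ?_
  refine (summable_norm_mulMode f).tsum_le_tsum (fun k => ?_) (summable_norm_l1 f)
  simpa using (mulMode k).le_of_opNorm_le (norm_mulMode_le k) (f k)

/-- Evaluation of a Fourier coefficient at a site. -/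
def evalSite (m : ℤ) (n : Fin d → ℤ) : Modes d →L[ℂ] ℂ :=
  (lp.evalCLM ℂ (fun _ : Fin d → ℤ => ℂ) 2 n).comp (lp.evalCLM ℂ (fun _ : ℤ => Latt d) 2 m)

@[simp]
theorem evalSite_apply (m : ℤ) (n : Fin d → ℤ) (F : Modes d) : evalSite m n F = F m n := rfl

theorem modeConv_apply (f : lp (fun _ : ℤ => Latt d) 1) (F : Modes d) (m : ℤ) (n : Fin d → ℤ) :
    modeConv f F m n = ∑' k, f k n * F (m - k) n := by
  rw [modeConv_eq_tsum, ← evalSite_apply,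
    ← ContinuousLinearMap.apply_apply (𝕜 := ℂ) F (∑' k, mulMode k (f k)),
    ← ContinuousLinearMap.comp_apply, ContinuousLinearMap.map_tsum _
      (summable_norm_mulMode f).of_norm]
  rfl

/-- Inherited termwise from `mulMode_commute`: both series converge absolutely in operator norm. -/
theorem modeConv_commute (f g : lp (fun _ : ℤ => Latt d) 1) :
    Commute (modeConv f) (modeConv g) := by
  have hf := (summable_norm_mulMode f).of_norm
  have hg := (summable_norm_mulMode g).of_norm
  rw [Commute, SemiconjBy, modeConv_eq_tsum, modeConv_eq_tsum, ← hf.tsum_mul_right,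
    ← hf.tsum_mul_left]
  refine tsum_congr fun j => ?_
  rw [← hg.tsum_mul_left, ← hg.tsum_mul_right]
  exact tsum_congr fun k => mulMode_commute _ _ _ _

/-! ### Products of absolutely convergent Fourier series and recovery of coefficients. -/

section Convolution

/-- The shear `(m, k) ↦ (k, m - k)` of `ℤ × ℤ`. -/
def convShear : ℤ × ℤ ≃ ℤ × ℤ where
  toFun x := (x.2, x.1 - x.2)
  invFun x := (x.1 + x.2, x.1)
  left_inv x := by simp
  right_inv x := by simp

variable {u v : ℤ → ℂ}

theorem summable_convShear (hu : Summable fun k => ‖u k‖) (hv : Summable fun k => ‖v k‖) :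
    Summable fun x : ℤ × ℤ => ‖u x.2 * v (x.1 - x.2)‖ :=
  convShear.summable_iff.mpr (hu.mul_norm hv)

theorem summable_norm_convolution (hu : Summable fun k => ‖u k‖) (hv : Summable fun k => ‖v k‖) :
    Summable fun m => ‖∑' k, u k * v (m - k)‖ := by
  have h := summable_convShear hu hv
  refine h.prod.of_nonneg_of_le (fun _ => norm_nonneg _) fun m => ?_
  exact norm_tsum_le_tsum_norm (h.prod_factor m)

theorem tsum_convolution (hu : Summable fun k => ‖u k‖) (hv : Summable fun k => ‖v k‖) :
    ∑' m, ∑' k, u k * v (m - k) = (∑' k, u k) * ∑' k, v k := by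
  rw [tsum_mul_tsum_of_summable_norm hu hv, ← convShear.tsum_eq]
  exact (summable_convShear hu hv).of_norm.tsum_prod.symm

end Convolution

theorem norm_exp_I_mul (m : ℤ) (τ : ℝ) : ‖exp (I * m * τ)‖ = 1 := by
  have : I * m * τ = ((m * τ : ℝ) : ℂ) * I := by push_cast; ring
  rw [this, norm_exp_ofReal_mul_I]

theorem fourierSum_convolution {A B C : ℤ → Latt d} {n : Fin d → ℤ}
    (hA : Summable fun k => ‖A k n‖) (hB : Summable fun k => ‖B k n‖)
    (hC : ∀ m, C m n = ∑' k, A k n * B (m - k) n) (τ : ℝ) :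
    fourierSum C n τ = fourierSum A n τ * fourierSum B n τ := by
  -- The exponentials are absorbed into the two sequences, so that the product of the series is a
  -- plain Cauchy product.
  have key := tsum_convolution (u := fun k => A k n * exp (I * k * τ))
    (v := fun k => B k n * exp (I * k * τ)) (by simpa [norm_exp_I_mul] using hA)
    (by simpa [norm_exp_I_mul] using hB)
  rw [fourierSum, fourierSum, fourierSum, ← key]
  refine tsum_congr fun m => ?_
  rw [hC, ← tsum_mul_right]
  refine tsum_congr fun k => ?_
  have : exp (I * m * τ) = exp (I * k * τ) * exp (I * (m - k : ℤ) * τ) := by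
    rw [← exp_add]
    congr 1
    push_cast
    ring
  rw [this]
  ring

theorem integral_exp_I_mul (j : ℤ) :
    ∫ τ in (-Real.pi)..Real.pi, exp (I * j * τ) = if j = 0 then 2 * (Real.pi : ℂ) else 0 := by
  split_ifs with h
  · subst h
    simp
    ring
  · have hc : I * (j : ℂ) ≠ 0 := mul_ne_zero I_ne_zero (by exact_mod_cast h)
    rw [integral_exp_mul_complex hc]
    -- The exponents at the two endpoints differ by 2πij, so the primitive takes equal values there.
    have : exp (I * j * (Real.pi : ℝ)) = exp (I * j * ((-Real.pi : ℝ) : ℂ)) := by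
      rw [exp_eq_exp_iff_exists_int]
      exact ⟨j, by push_cast; ring⟩
    rw [this, sub_self, zero_div]

/-- Orthogonality of the exponentials. Absolute summability allows integrating term by term. -/
theorem integral_fourierSum {C : ℤ → Latt d} {n : Fin d → ℤ} (hC : Summable fun k => ‖C k n‖)
    (m : ℤ) :
    ∫ τ in (-Real.pi)..Real.pi, fourierSum C n τ * exp (-(I * m * τ))
      = 2 * Real.pi * C m n := by
  let f : ℤ → C(ℝ, ℂ) := fun k =>
    ⟨fun τ => C k n * exp (I * (k - m : ℤ) * τ), by fun_prop⟩
  have hf : ∀ τ : ℝ, fourierSum C n τ * exp (-(I * m * τ)) = ∑' k, f k τ := fun τ => by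
    rw [fourierSum, ← tsum_mul_right]
    refine tsum_congr fun k => ?_
    change _ = C k n * exp (I * (k - m : ℤ) * τ)
    rw [mul_assoc, ← exp_add]
    congr 2
    push_cast
    ring
  simp_rw [hf]
  rw [← intervalIntegral.tsum_intervalIntegral_eq_of_summable_norm]
  · rw [tsum_eq_single m]
    · change ∫ τ in (-Real.pi)..Real.pi, C m n * exp (I * (m - m : ℤ) * τ) = _
      rw [intervalIntegral.integral_const_mul, integral_exp_I_mul, if_pos (sub_self m)]
      ring
    · intro k hk
      change ∫ τ in (-Real.pi)..Real.pi, C k n * exp (I * (k - m : ℤ) * τ) = _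
      rw [intervalIntegral.integral_const_mul, integral_exp_I_mul, if_neg (sub_ne_zero.mpr hk),
        mul_zero]
  · refine hC.of_nonneg_of_le (fun _ => norm_nonneg _) fun k => ?_
    refine (ContinuousMap.norm_le _ (norm_nonneg _)).mpr fun τ => ?_
    change ‖C k n * exp (I * (k - m : ℤ) * _)‖ ≤ _
    rw [norm_mul, norm_exp_I_mul, mul_one]

/-! ### Weighted sequences and multiplication by Fourier series in ℓ^{2,2}. -/

/-- The weight `1 / (1 + m²)`. -/
def wt (m : ℤ) : ℂ := (1 + (m : ℂ) ^ 2)⁻¹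

theorem one_add_sq_ne_zero (m : ℤ) : (1 + (m : ℂ) ^ 2) ≠ 0 := by
  have : (0 : ℝ) < 1 + (m : ℝ) ^ 2 := by positivity
  exact_mod_cast this.ne'

theorem norm_wt (m : ℤ) : ‖wt m‖ = (1 + (m : ℝ) ^ 2)⁻¹ := by
  have : wt m = (((1 + (m : ℝ) ^ 2)⁻¹ : ℝ) : ℂ) := by rw [wt]; push_cast; rfl
  rw [this, norm_real, Real.norm_of_nonneg (by positivity)]

theorem norm_wt_le (m : ℤ) : ‖wt m‖ ≤ 1 := by
  rw [norm_wt]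
  exact inv_le_one_of_one_le₀ (by nlinarith [sq_nonneg (m : ℝ)])

theorem summable_norm_wt : Summable fun m : ℤ => ‖wt m‖ := by
  have h1 : Summable fun m : ℤ => 1 / (m : ℝ) ^ 2 :=
    Real.summable_one_div_int_pow.mpr (by norm_num)
  have h2 : Summable fun m : ℤ => if m = 0 then (1 : ℝ) else 0 :=
    summable_of_ne_finset_zero (s := {0}) fun m hm => if_neg (by simpa using hm)
  refine (h1.add h2).of_nonneg_of_le (fun _ => norm_nonneg _) fun m => ?_
  rw [norm_wt]
  split_ifs with h
  · subst h
    simp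
  · have : (0 : ℝ) < (m : ℝ) ^ 2 := by positivity
    rw [add_zero, one_div]
    exact inv_anti₀ this (by linarith)

/-- The sum of the weights. -/
def wtSum : ℝ := ∑' m : ℤ, ‖wt m‖

theorem summable_norm_wt_smul (F : Modes d) : Summable fun m => ‖wt m • F m‖ := by
  refine (summable_norm_wt.mul_right ‖F‖).of_nonneg_of_le (fun _ => norm_nonneg _) fun m => ?_
  rw [norm_smul]
  gcongr
  exact norm_mode_le F m

theorem tsum_norm_wt_smul_le (F : Modes d) : ∑' m, ‖wt m • F m‖ ≤ wtSum * ‖F‖ := by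
  rw [wtSum, ← tsum_mul_right]
  refine (summable_norm_wt_smul F).tsum_le_tsum (fun m => ?_) (summable_norm_wt.mul_right ‖F‖)
  rw [norm_smul]
  gcongr
  exact norm_mode_le F m

/-- The inclusion of `ℓ^{2,2}` into `ℓ¹`, in terms of the weighted sequence. -/
def toL1 : Modes d →L[ℂ] lp (fun _ : ℤ => Latt d) 1 :=
  LinearMap.mkContinuous
    { toFun := fun F => ⟨fun m => wt m • F m, by
        apply memℓp_gen
        simpa using summable_norm_wt_smul F⟩
      map_add' := fun F G => by
        refine lp.ext (funext fun m => ?_)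
        exact smul_add _ _ _
      map_smul' := fun c F => by
        refine lp.ext (funext fun m => ?_)
        exact smul_comm (wt m) c (F m) }
    wtSum (fun F => by
      rw [lp.norm_eq_tsum_rpow (by norm_num)]
      simpa using tsum_norm_wt_smul_le F)

@[simp]
theorem toL1_apply (F : Modes d) (m : ℤ) : toL1 F m = wt m • F m := rfl

theorem norm_smul_id_le (c : ℂ) : ‖c • ContinuousLinearMap.id ℂ (Latt d)‖ ≤ ‖c‖ := by
  rw [norm_smul]
  exact mul_le_of_le_one_right (norm_nonneg _) ContinuousLinearMap.norm_id_le

/-- The Fourier multiplier with a bounded symbol. -/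
def multiplier (c : ℤ → ℂ) (hc : ∀ m, ‖c m‖ ≤ 2) : Modes d →L[ℂ] Modes d :=
  lp.mapCLM 2 (fun m => c m • ContinuousLinearMap.id ℂ (Latt d)) zero_le_two
    fun m => (norm_smul_id_le (c m)).trans (hc m)

@[simp]
theorem multiplier_apply (c : ℤ → ℂ) (hc : ∀ m, ‖c m‖ ≤ 2) (F : Modes d) (m : ℤ) :
    multiplier c hc F m = c m • F m := rfl

/-- The operator that turns the weighted sequence into the sequence of Fourier coefficients. -/
def unweight : Modes d →L[ℂ] Modes d :=
  multiplier wt fun m => (norm_wt_le m).trans one_le_two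

@[simp]
theorem unweight_apply (F : Modes d) (m : ℤ) : unweight F m = wt m • F m := rfl

/-- The multiplication by the Fourier series whose weighted sequence of coefficients is given. -/
def fourierMul : Modes d →L[ℂ] (Modes d →L[ℂ] Modes d) := modeConv.comp toL1

theorem fourierMul_apply (F G : Modes d) (m : ℤ) (n : Fin d → ℤ) :
    fourierMul F G m n = ∑' k, wt k * F k n * G (m - k) n :=
  modeConv_apply _ _ _ _

theorem fourierMul_commute (F G : Modes d) : Commute (fourierMul F) (fourierMul G) :=
  modeConv_commute _ _

/-- The product of two functions is symmetric. The `unweight` appears because `fourierMul` takes a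
weighted sequence as symbol but acts on an unweighted one. -/
theorem fourierMul_unweight_comm (F G : Modes d) :
    fourierMul F (unweight G) = fourierMul G (unweight F) := by
  refine Modes.ext' fun m n => ?_
  rw [fourierMul_apply, fourierMul_apply, ← (Equiv.subLeft m).tsum_eq]
  refine tsum_congr fun k => ?_
  simp
  ring

/-- The operator norm sees only the ℓ¹ norm of the coefficients. This is the norm in which a
breather branch is controlled; no smallness in ℓ^{2,2} will be needed. -/
theorem norm_fourierMul_le (F : Modes d) : ‖fourierMul F‖ ≤ ∑' k, ‖wt k • F k‖ :=
  norm_modeConv_le _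

theorem norm_site_le (u : Latt d) (n : Fin d → ℤ) : ‖u n‖ ≤ ‖u‖ :=
  lp.norm_apply_le_norm (by norm_num) u n

theorem summable_norm_site {A : ℤ → Latt d} (hA : Summable fun k => ‖A k‖) (n : Fin d → ℤ) :
    Summable fun k => ‖A k n‖ :=
  hA.of_nonneg_of_le (fun _ => norm_nonneg _) fun k => norm_site_le (A k) n

theorem summable_norm_fourierMul (F : Modes d) {H : Modes d} {n : Fin d → ℤ}
    (hH : Summable fun m => ‖H m n‖) : Summable fun m => ‖fourierMul F H m n‖ :=
  (summable_norm_convolution (summable_norm_site (summable_norm_wt_smul F) n) hH).congr fun m => by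
    rw [fourierMul_apply]
    rfl

theorem fourierSum_fourierMul (F : Modes d) {H : Modes d} {n : Fin d → ℤ}
    (hH : Summable fun m => ‖H m n‖) (τ : ℝ) :
    fourierSum (fun m => fourierMul F H m) n τ
      = fourierSum (fun m => wt m • F m) n τ * fourierSum (fun m => H m) n τ :=
  fourierSum_convolution (summable_norm_site (summable_norm_wt_smul F) n) hH
    (fun m => by
      rw [fourierMul_apply]
      rfl) τ

/-- Peels the new factor off on the left, the form used in the inductions on the power. -/
theorem fourierMul_pow_succ_apply (F G : Modes d) (j : ℕ) :
    (fourierMul F ^ (j + 1)) G = fourierMul F ((fourierMul F ^ j) G) := by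
  rw [pow_succ', mul_apply_eq_comp]

/-- Summability is carried along in the induction because the product formula for the next factor
requires it. -/
theorem fourierMul_pow_unweight (F G : Modes d) (n : Fin d → ℤ) (j : ℕ) :
    (Summable fun m => ‖(fourierMul F ^ j) (unweight G) m n‖) ∧
      ∀ τ, fourierSum (fun m => (fourierMul F ^ j) (unweight G) m) n τ
        = fourierSum (fun m => wt m • F m) n τ ^ j * fourierSum (fun m => wt m • G m) n τ := by
  induction j with
  | zero =>
    refine ⟨?_, fun τ => ?_⟩
    · exact summable_norm_site (summable_norm_wt_smul G) n
    · rw [pow_zero (fourierSum _ n τ), one_mul]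
      rfl
  | succ j ih =>
    rw [fourierMul_pow_succ_apply]
    refine ⟨summable_norm_fourierMul F ih.1, fun τ => ?_⟩
    rw [fourierSum_fourierMul F ih.1, ih.2, pow_succ', mul_assoc]

theorem integral_fourierSum_pow_mul (F G : Modes d) (j : ℕ) (m : ℤ) (n : Fin d → ℤ) :
    ∫ τ in (-Real.pi)..Real.pi, fourierSum (fun m => wt m • F m) n τ ^ j
        * fourierSum (fun m => wt m • G m) n τ * exp (-(I * m * τ))
      = 2 * Real.pi * (fourierMul F ^ j) (unweight G) m n := by
  have h := fourierMul_pow_unweight F G n j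
  simp_rw [← h.2]
  exact integral_fourierSum h.1 m

/-! ### Fredholm alternative, the spectrum of the Laplacian, and compact potentials. -/

/-- Write S + K = -S(-1 - S⁻¹K) and apply the Fredholm alternative to the compact operator S⁻¹K at
-1. An eigenvector there would be annihilated by S + K. -/
theorem isUnit_add_of_isCompactOperator {X : Type*} [NormedAddCommGroup X] [NormedSpace ℂ X]
    [CompleteSpace X] {S K : X →L[ℂ] X} (hS : IsUnit S) (hK : IsCompactOperator K)
    (hinj : ∀ x, S x + K x = 0 → x = 0) : IsUnit (S + K) := by
  obtain ⟨s, rfl⟩ := hS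
  let K' : X →L[ℂ] X := (↑s⁻¹ : X →L[ℂ] X) * K
  have hK' : IsCompactOperator K' := hK.clm_comp (↑s⁻¹ : X →L[ℂ] X)
  have hsK : (s : X →L[ℂ] X) * K' = K := by simp [K']
  have hfac : (s : X →L[ℂ] X) + K = -(s * (algebraMap ℂ _ (-1) - K')) := by
    rw [mul_sub, hsK]
    simp [add_comm]
  rcases hK'.hasEigenvalue_or_mem_resolventSet (μ := -1) (by norm_num) with h | h
  · obtain ⟨x, hx⟩ := h.exists_hasEigenvector
    refine absurd (hinj x ?_) hx.2
    have h1 : K' x = -x := by simpa using hx.apply_eq_smul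
    have h2 : K x = (s : X →L[ℂ] X) (K' x) := by rw [← hsK]; rfl
    rw [h2, h1, map_neg, add_neg_cancel]
  · rw [hfac]
    exact (s.isUnit.mul h).neg

theorem norm_shift_le (v : Fin d → ℤ) : ‖shift v‖ ≤ 1 :=
  LinearMap.mkContinuous_norm_le _ zero_le_one _

/-- Adding 2d removes the diagonal and leaves a sum of 2d translations. -/
theorem norm_lap_add_le : ‖lap d + (2 * d : ℂ) • (1 : Latt d →L[ℂ] Latt d)‖ ≤ 2 * d := by
  have h : lap d + (2 * d : ℂ) • (1 : Latt d →L[ℂ] Latt d)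
      = ∑ j : Fin d, (shift (Pi.single j 1) + shift (-Pi.single j 1)) := by
    rw [lap, Finset.sum_sub_distrib]
    simp only [Finset.sum_const, Finset.card_univ, Fintype.card_fin]
    rw [← Nat.cast_smul_eq_nsmul ℂ, smul_smul, mul_comm (d : ℂ)]
    exact sub_add_cancel _ _
  rw [h]
  refine (norm_sum_le _ _).trans ?_
  refine (Finset.sum_le_card_nsmul _ _ 2 fun j _ => ?_).trans ?_
  · refine (norm_add_le _ _).trans ?_
    linarith [norm_shift_le (Pi.single j 1 : Fin d → ℤ), norm_shift_le (-Pi.single j 1 : Fin d → ℤ)]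
  · simp [mul_comm]

/-- For real c, lying outside [-4d, 0] means |c + 2d| > 2d, which exceeds the norm of Δ + 2d. A
Neumann series suffices and self-adjointness plays no role. -/
theorem isUnit_smul_one_sub_lap {c : ℝ} (hc : c ∉ Set.Icc (-(4 * d : ℝ)) 0) :
    IsUnit ((c : ℂ) • (1 : Latt d →L[ℂ] Latt d) - lap d) := by
  have hlt : (2 * d : ℝ) < |c + 2 * d| := by
    rw [lt_abs]
    by_contra! h
    exact hc ⟨by linarith, by linarith⟩
  have hmem : ((c + 2 * d : ℝ) : ℂ) ∈
      resolventSet ℂ (lap d + (2 * d : ℂ) • (1 : Latt d →L[ℂ] Latt d)) := by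
    refine spectrum.mem_resolventSet_of_norm_lt_mul ?_
    rw [norm_real, Real.norm_eq_abs]
    refine lt_of_le_of_lt ?_ hlt
    refine (mul_le_of_le_one_right (norm_nonneg _) ContinuousLinearMap.norm_id_le).trans ?_
    exact norm_lap_add_le
  have h : IsUnit _ := hmem
  rw [Algebra.algebraMap_eq_smul_one] at h
  convert h using 1
  push_cast
  rw [add_smul]
  abel

/-- An ℓ² sequence is the limit of its finite truncations, multiplication depends continuously on it
in operator norm, and a truncation acts with finite rank. -/
theorem isCompactOperator_siteMul (u : Latt d) : IsCompactOperator (siteMul u) := by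
  have hsum := (lp.hasSum_single (by norm_num) u).map (siteMul (d := d)) siteMul.continuous
  refine isCompactOperator_of_tendsto hsum (Eventually.of_forall fun s => ?_)
  have hfun : IsCompactOperator (∑ n ∈ s, siteMul (lp.single 2 n (u n)) : Latt d →L[ℂ] Latt d) := by
    refine Finset.sum_induction _ (fun K : Latt d →L[ℂ] Latt d => IsCompactOperator K)
      (fun K L hK hL => hK.add hL) isCompactOperator_zero fun n _ => ?_
    have heq : siteMul (lp.single 2 n (u n))
        = (u n • lp.singleContinuousLinearMap ℂ (fun _ : Fin d → ℤ => ℂ) 2 n).comp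
          (lp.evalCLM ℂ (fun _ : Fin d → ℤ => ℂ) 2 n) := by
      ext v k
      change (lp.single 2 n (u n) : Latt d) k * v k = u n * (lp.single 2 n (v n) : Latt d) k
      rcases eq_or_ne k n with rfl | hk
      · rw [lp.single_apply_self, lp.single_apply_self]
      · rw [lp.single_apply_ne _ _ _ hk, lp.single_apply_ne _ _ _ hk, zero_mul, mul_zero]
    rw [heq]
    exact (isCompactOperator_of_locallyCompactSpace_rng
      (u n • lp.singleContinuousLinearMap ℂ (fun _ : Fin d → ℤ => ℂ) 2 n)).comp_clm _
  exact hfun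

@[simp]
theorem mulAbsPow_apply (a u : Latt d) (k : ℕ) (n : Fin d → ℤ) :
    mulAbsPow a k u n = ((‖a n‖ : ℂ) ^ k) * u n := rfl

theorem siteMul_pow_apply (a u : Latt d) (k : ℕ) (n : Fin d → ℤ) :
    (siteMul a ^ k) u n = a n ^ k * u n := by
  induction k generalizing u with
  | zero => simp
  | succ k ih =>
    rw [pow_succ, mul_apply_eq_comp, ih, siteMul_apply, pow_succ, mul_assoc]

theorem siteMul_pow_eq_mulAbsPow {a : Latt d} (ha : ∀ n, (a n).im = 0) (p : ℕ) :
    siteMul a ^ (2 * p) = mulAbsPow a (2 * p) := by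
  ext u n
  rw [siteMul_pow_apply, mulAbsPow_apply, pow_mul, pow_mul]
  congr 2
  rw [← ofReal_pow, ← normSq_eq_norm_sq]
  apply Complex.ext
  · simp [pow_two, normSq_apply, ha n]
  · simp [pow_two, ha n]

/-- At least one factor of a is needed: for p = 0 the operator would be the identity. -/
theorem isCompactOperator_mulAbsPow {a : Latt d} (ha : ∀ n, (a n).im = 0) {p : ℕ} (hp : 1 ≤ p) :
    IsCompactOperator (mulAbsPow a (2 * p)) := by
  rw [← siteMul_pow_eq_mulAbsPow ha]
  obtain ⟨q, hq⟩ : ∃ q, 2 * p = q + 1 := ⟨2 * p - 1, by omega⟩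
  rw [hq, pow_succ']
  exact (isCompactOperator_siteMul a).comp_clm _

/-! ### The limit problem on the modes ±1 and its equivalence with the linearised dNLS operator. -/

/-- The diagonal part of the linearised stationary problem for the modes `±1`. -/
def pairDiag (d : ℕ) (Ω : ℝ) (σ : ℂ) : (Latt d × Latt d) →L[ℂ] (Latt d × Latt d) :=
  ((Ω + 2 * I * σ) • (1 : Latt d →L[ℂ] Latt d) - lap d).prodMap
    ((Ω - 2 * I * σ) • (1 : Latt d →L[ℂ] Latt d) - lap d)

/-- The operator `(x, y) ↦ (α S x + β S y, α S y + β S x)`. -/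
def pairPot (S : Latt d →L[ℂ] Latt d) (α β : ℂ) :
    (Latt d × Latt d) →L[ℂ] (Latt d × Latt d) :=
  ((ContinuousLinearMap.inl ℂ (Latt d) (Latt d)).comp S).comp
      (α • ContinuousLinearMap.fst ℂ (Latt d) (Latt d)
        + β • ContinuousLinearMap.snd ℂ (Latt d) (Latt d))
    + ((ContinuousLinearMap.inr ℂ (Latt d) (Latt d)).comp S).comp
      (α • ContinuousLinearMap.snd ℂ (Latt d) (Latt d)
        + β • ContinuousLinearMap.fst ℂ (Latt d) (Latt d))

theorem pairDiag_apply (Ω : ℝ) (σ : ℂ) (x y : Latt d) :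
    pairDiag d Ω σ (x, y)
      = ((Ω + 2 * I * σ) • x - lap d x, (Ω - 2 * I * σ) • y - lap d y) := rfl

theorem pairPot_apply (S : Latt d →L[ℂ] Latt d) (α β : ℂ) (x y : Latt d) :
    pairPot S α β (x, y) = (α • S x + β • S y, α • S y + β • S x) := by
  simp [pairPot]

theorem isCompactOperator_pairPot {S : Latt d →L[ℂ] Latt d} (hS : IsCompactOperator S) (α β : ℂ) :
    IsCompactOperator (pairPot S α β) :=
  ((hS.clm_comp (ContinuousLinearMap.inl ℂ (Latt d) (Latt d))).comp_clm _).add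
    ((hS.clm_comp (ContinuousLinearMap.inr ℂ (Latt d) (Latt d))).comp_clm _)

theorem isUnit_pairDiag {Ω : ℝ} {σ : ℂ} (hσ : σ.re = 0)
    (h1 : Ω - 2 * σ.im ∉ Set.Icc (-(4 * d : ℝ)) 0) (h2 : Ω + 2 * σ.im ∉ Set.Icc (-(4 * d : ℝ)) 0) :
    IsUnit (pairDiag d Ω σ) := by
  have hσ' : σ = σ.im * I := by
    apply Complex.ext <;> simp [hσ]
  -- For imaginary σ the two constants are real, so the real criterion for invertibility applies to
  -- each component.
  have e1 : (Ω : ℂ) + 2 * I * σ = ((Ω - 2 * σ.im : ℝ) : ℂ) := by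
    conv_lhs => rw [hσ']
    push_cast
    linear_combination 2 * (σ.im : ℂ) * I_mul_I
  have e2 : (Ω : ℂ) - 2 * I * σ = ((Ω + 2 * σ.im : ℝ) : ℂ) := by
    conv_lhs => rw [hσ']
    push_cast
    linear_combination -2 * (σ.im : ℂ) * I_mul_I
  rw [ContinuousLinearMap.isUnit_iff_bijective, pairDiag, e1, e2]
  exact ((ContinuousLinearMap.isUnit_iff_bijective).mp (isUnit_smul_one_sub_lap h1)).prodMap
    ((ContinuousLinearMap.isUnit_iff_bijective).mp (isUnit_smul_one_sub_lap h2))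

/-- The coefficient of the diagonal interaction of the modes `±1`. -/
def alph (p : ℕ) : ℂ := (1 + 2 * p) * ((2 * p).choose p : ℂ)

/-- The coefficient of the interaction between the modes `1` and `-1`. -/
def bet (p : ℕ) : ℂ := (1 + 2 * p) * ((2 * p).choose (p + 1) : ℂ)

/-- Pascal's rule. The sum acts on the symmetric combination b₊ and gives the potential of J_Ω. -/
theorem alph_add_bet (p : ℕ) : alph p + bet p = (((1 + 2 * p) * gam p : ℝ) : ℂ) := by
  have h : ((1 + 2 * p).choose (1 + p)) = (2 * p).choose p + (2 * p).choose (p + 1) := by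
    rw [add_comm 1 (2 * p), add_comm 1 p, Nat.choose_succ_succ]
  rw [alph, bet, gam, h]
  push_cast
  ring

/-- Since C(2p, p+1) = p/(p+1) · C(2p, p), the difference equals (2p+1)/(p+1) · C(2p, p) = C(2p+1,
p+1). It acts on the antisymmetric combination b₋. -/
theorem alph_sub_bet (p : ℕ) : alph p - bet p = ((1 * gam p : ℝ) : ℂ) := by
  have h1 : ((2 * p + 1 : ℕ) : ℂ) * ((2 * p).choose p : ℂ)
      = ((1 + 2 * p).choose (1 + p) : ℂ) * ((p + 1 : ℕ) : ℂ) := by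
    rw [add_comm 1 (2 * p), add_comm 1 p]
    exact_mod_cast Nat.add_one_mul_choose_eq (2 * p) p
  have h2 : ((2 * p).choose (p + 1) : ℂ) * ((p + 1 : ℕ) : ℂ) = ((2 * p).choose p : ℂ) * p := by
    have := Nat.choose_succ_right_eq (2 * p) p
    rw [show 2 * p - p = p by omega] at this
    exact_mod_cast this
  have h3 : ((p + 1 : ℕ) : ℂ) ≠ 0 := by exact_mod_cast Nat.succ_ne_zero p
  apply mul_right_cancel₀ h3
  rw [alph, bet, gam]
  push_cast at *
  linear_combination (1 + 2 * (p : ℂ)) * (-h2) + h1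

/-- The linearised stationary problem for the modes `±1`, with eigenvalue parameter `σ`. -/
def pairOp (p : ℕ) (Ω : ℝ) (a : Latt d) (σ : ℂ) : (Latt d × Latt d) →L[ℂ] (Latt d × Latt d) :=
  pairDiag d Ω σ + pairPot (mulAbsPow a (2 * p)) (alph p) (bet p)

/-- The change of variables `(b₊, b₋) ↦ (b₊ + i b₋, b₊ - i b₋)`. -/
def polarize (b : Latt d × Latt d) : Latt d × Latt d := (b.1 + I • b.2, b.1 - I • b.2)

/-- The map `(u₁, u₂) ↦ (u₂ - i u₁, u₂ + i u₁)`. -/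
def copolarize (u : Latt d × Latt d) : Latt d × Latt d := (u.2 - I • u.1, u.2 + I • u.1)

theorem exists_polarize_eq (z : Latt d × Latt d) : ∃ b, polarize b = z := by
  refine ⟨((1 / 2 : ℂ) • (z.1 + z.2), (-(I / 2)) • (z.1 - z.2)), ?_⟩
  have hI : I * -(I / 2) = 1 / 2 := by linear_combination (-1 / 2 : ℂ) * I_mul_I
  refine Prod.ext ?_ ?_ <;> simp only [polarize, smul_smul, hI] <;> module

theorem copolarize_eq_zero {u : Latt d × Latt d} (hu : copolarize u = 0) : u = 0 := by
  have h1 : u.2 - I • u.1 = 0 := congrArg Prod.fst hu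
  have h2 : u.2 + I • u.1 = 0 := congrArg Prod.snd hu
  have h3 : (2 : ℂ) • u.2 = 0 := by
    rw [← add_zero (0 : Latt d), ← congrArg₂ (· + ·) h1 h2]
    module
  have h4 : u.2 = 0 := (smul_eq_zero_iff_right two_ne_zero).mp h3
  rw [h4, zero_add] at h2
  exact Prod.ext ((smul_eq_zero_iff_right I_ne_zero).mp h2) h4

/-- The bridge to dNLS: sums and differences of the two components diagonalise the interaction into
α + β and α - β, while the opposite terms ±2iσ couple them. Thus kernel and bordering questions for
`pairOp` become questions about `linNLS`. -/
theorem pairOp_polarize (p : ℕ) (Ω : ℝ) (a : Latt d) (σ : ℂ) (b : Latt d × Latt d) :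
    pairOp p Ω a σ (polarize b) = copolarize (linNLS p Ω a b - (2 * σ) • b) := by
  obtain ⟨b₁, b₂⟩ := b
  have hL : linNLS p Ω a (b₁, b₂) = (-(schr p Ω 1 a b₂), jac p Ω a b₁) := rfl
  have hs : ∀ (c : ℝ) (x : Latt d), schr p Ω c a x
      = (Ω : ℂ) • x - lap d x + ((c * gam p : ℝ) : ℂ) • mulAbsPow a (2 * p) x := fun _ _ => rfl
  have hII : ∀ x : Latt d, I • I • x = -x := fun x => by rw [smul_smul, I_mul_I, neg_one_smul]
  rw [hL, jac, hs, hs, ← alph_add_bet, ← alph_sub_bet, pairOp, add_apply,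
    polarize, pairDiag_apply, pairPot_apply]
  simp only [copolarize, map_add, map_sub, map_smul]
  generalize mulAbsPow a (2 * p) b₁ = s₁
  generalize mulAbsPow a (2 * p) b₂ = s₂
  generalize lap d b₁ = l₁
  generalize lap d b₂ = l₂
  refine Prod.ext ?_ ?_
  · simp only [Prod.fst_add, Prod.fst_sub, Prod.snd_sub, Prod.smul_fst, Prod.smul_snd]
    linear_combination (norm := module) (2 * σ) • hII b₂
  · simp only [Prod.snd_add, Prod.fst_sub, Prod.snd_sub, Prod.smul_fst, Prod.smul_snd]
    linear_combination (norm := module) (2 * σ) • hII b₂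

/-! ### The rescaled spectral operator on all modes. -/

theorem norm_mul_wt_le (m : ℤ) : ‖(m : ℂ) * wt m‖ ≤ 2 := by
  rw [norm_mul, norm_wt, norm_intCast, ← div_eq_mul_inv, div_le_iff₀ (by positivity)]
  nlinarith [sq_abs (m : ℝ), sq_nonneg (|(m : ℝ)| - 1)]

theorem norm_sq_mul_wt_le (m : ℤ) : ‖(m : ℂ) ^ 2 * wt m‖ ≤ 2 := by
  rw [norm_mul, norm_wt, norm_pow, norm_intCast, sq_abs, ← div_eq_mul_inv,
    div_le_iff₀ (by positivity)]
  nlinarith [sq_nonneg (m : ℝ)]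

/-- The multiplier with symbol `m / (1 + m²)`. -/
def unweightDeriv : Modes d →L[ℂ] Modes d := multiplier (fun m => m * wt m) norm_mul_wt_le

/-- The multiplier with symbol `m² / (1 + m²)`. -/
def unweightDerivSq : Modes d →L[ℂ] Modes d :=
  multiplier (fun m => m ^ 2 * wt m) norm_sq_mul_wt_le

/-- The projection to the Fourier modes `±1`. -/
def near : Modes d →L[ℂ] Modes d :=
  multiplier (fun m => if m = 1 ∨ m = -1 then 1 else 0) fun m => by split_ifs <;> simp

/-- The projection to the Fourier modes other than `±1`. -/
def far : Modes d →L[ℂ] Modes d :=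
  multiplier (fun m => if m = 1 ∨ m = -1 then 0 else 1) fun m => by split_ifs <;> simp

theorem near_apply (F : Modes d) (m : ℤ) :
    near F m = if m = 1 ∨ m = -1 then F m else 0 := by
  rw [near, multiplier_apply, ite_smul, one_smul, zero_smul]

theorem far_apply (F : Modes d) (m : ℤ) :
    far F m = if m = 1 ∨ m = -1 then 0 else F m := by
  rw [far, multiplier_apply, ite_smul, one_smul, zero_smul]

/-- The operator of the dKG spectral problem in the weighted variables, for the eigenvalue `ε σ`
and the potential `V`; the equations for the modes `±1` are divided by `ε`, with
`θ = (1 - ω²) / ε`. -/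
def kgOp (ε ω θ σ : ℂ) (V : Modes d →L[ℂ] Modes d) : Modes d →L[ℂ] Modes d :=
  far * ((1 + ε ^ 2 * σ ^ 2) • unweight + (2 * I * ε * σ * ω) • unweightDeriv
      - ω ^ 2 • unweightDerivSq + ε • ((V - mapModes (lap d)) * unweight))
    + near * ((θ + ε * σ ^ 2) • unweight + (2 * I * ω * σ) • unweightDeriv
      + (V - mapModes (lap d)) * unweight)

theorem kgOp_apply_far (ε ω θ σ : ℂ) (V : Modes d →L[ℂ] Modes d) (F : Modes d) {m : ℤ}
    (hm : ¬(m = 1 ∨ m = -1)) :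
    kgOp ε ω θ σ V F m = (1 + (ε * σ + I * m * ω) ^ 2) • wt m • F m + ε • V (unweight F) m
      - ε • lap d (wt m • F m) := by
  have h : kgOp ε ω θ σ V F m = (1 + ε ^ 2 * σ ^ 2) • wt m • F m
      + (2 * I * ε * σ * ω) • ((m : ℂ) * wt m) • F m - ω ^ 2 • ((m : ℂ) ^ 2 * wt m) • F m
      + ε • (V (unweight F) m - lap d (wt m • F m)) := by
    rw [kgOp, add_apply, lp.coeFn_add, Pi.add_apply, mul_apply_eq_comp, mul_apply_eq_comp,
      near_apply, if_neg hm, far_apply, if_neg hm, add_zero]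
    rfl
  rw [h]
  -- Expands (εσ + imω)²; only i² = -1 is not a module identity.
  linear_combination (norm := module) (-(m : ℂ) ^ 2 * ω ^ 2 * wt m * I_mul_I) • F m

theorem kgOp_apply_near (ε ω θ σ : ℂ) (V : Modes d →L[ℂ] Modes d) (F : Modes d) {m : ℤ}
    (hm : m = 1 ∨ m = -1) :
    kgOp ε ω θ σ V F m = (θ + ε * σ ^ 2 + 2 * I * ω * σ * m) • wt m • F m + V (unweight F) m
      - lap d (wt m • F m) := by
  have h : kgOp ε ω θ σ V F m = (θ + ε * σ ^ 2) • wt m • F m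
      + (2 * I * ω * σ) • ((m : ℂ) * wt m) • F m
      + (V (unweight F) m - lap d (wt m • F m)) := by
    rw [kgOp, add_apply, lp.coeFn_add, Pi.add_apply, mul_apply_eq_comp, mul_apply_eq_comp,
      near_apply, if_pos hm, far_apply, if_pos hm, zero_add]
    rfl
  rw [h]
  module

/-! ### The block of modes ±1 and the limit operator at ε = 0. -/

/-- The Fourier coefficients with indices `±1`. -/
def pairOut : Modes d →L[ℂ] Latt d × Latt d :=
  (wt 1 • lp.evalCLM ℂ (fun _ : ℤ => Latt d) 2 1).prod
    (wt (-1) • lp.evalCLM ℂ (fun _ : ℤ => Latt d) 2 (-1))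

theorem pairOut_apply (F : Modes d) : pairOut F = (wt 1 • F 1, wt (-1) • F (-1)) := rfl

/-- The sequence with given entries at the indices `±1` and zero elsewhere. -/
def pairIn : Latt d × Latt d →L[ℂ] Modes d :=
  (lp.singleContinuousLinearMap ℂ (fun _ : ℤ => Latt d) 2 1).coprod
    (lp.singleContinuousLinearMap ℂ (fun _ : ℤ => Latt d) 2 (-1))

theorem pairIn_apply (z : Latt d × Latt d) (m : ℤ) :
    pairIn z m = (if m = 1 then z.1 else 0) + (if m = -1 then z.2 else 0) := by
  change (lp.single 2 1 z.1 : Modes d) m + (lp.single 2 (-1) z.2 : Modes d) m = _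
  rw [lp.single_apply, lp.single_apply, Pi.single_apply, Pi.single_apply]

@[simp]
theorem pairIn_one (z : Latt d × Latt d) : pairIn z 1 = z.1 := by
  rw [pairIn_apply, if_pos rfl, if_neg (by norm_num), add_zero]

@[simp]
theorem pairIn_neg_one (z : Latt d × Latt d) : pairIn z (-1) = z.2 := by
  rw [pairIn_apply, if_pos rfl, if_neg (by norm_num), zero_add]

theorem pairIn_far (z : Latt d × Latt d) {m : ℤ} (hm : ¬(m = 1 ∨ m = -1)) : pairIn z m = 0 := by
  rw [not_or] at hm
  rw [pairIn_apply, if_neg hm.1, if_neg hm.2, add_zero]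

theorem eq_pairIn {F : Modes d} (hF : ∀ m, ¬(m = 1 ∨ m = -1) → F m = 0) :
    F = pairIn (F 1, F (-1)) := by
  refine lp.ext (funext fun m => ?_)
  by_cases hm : m = 1 ∨ m = -1
  · rcases hm with rfl | rfl <;> simp
  · rw [hF m hm, pairIn_far _ hm]

theorem wt_one : wt 1 = 1 / 2 := by rw [wt]; norm_num

theorem wt_neg_one : wt (-1) = 1 / 2 := by rw [wt]; norm_num

/-- The factor 2 is the weight 1 + m² at m = ±1, so `2 • pairIn z` is the weighted form of `pairIn
z`. -/
theorem unweight_two_smul_pairIn (z : Latt d × Latt d) :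
    unweight ((2 : ℂ) • pairIn z) = pairIn z := by
  refine lp.ext (funext fun m => ?_)
  rw [unweight_apply, lp.coeFn_smul, Pi.smul_apply, smul_smul]
  by_cases hm : m = 1 ∨ m = -1
  · rcases hm with rfl | rfl
    · rw [wt_one]; norm_num
    · rw [wt_neg_one]; norm_num
  · rw [pairIn_far _ hm, smul_zero]

theorem mapModes_pairIn (K : Latt d →L[ℂ] Latt d) (z : Latt d × Latt d) :
    mapModes K (pairIn z) = pairIn (K z.1, K z.2) := by
  refine lp.ext (funext fun m => ?_)
  rw [mapModes_apply, pairIn_apply, pairIn_apply, map_add, apply_ite K, apply_ite K, map_zero]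

theorem pairOut_two_smul_pairIn (z : Latt d × Latt d) : pairOut ((2 : ℂ) • pairIn z) = z := by
  rw [map_smul, pairOut_apply, pairIn_one, pairIn_neg_one, wt_one, wt_neg_one]
  refine Prod.ext ?_ ?_ <;> simp

/-- The symbol is 2a cos τ, the leading part of the breather. -/
theorem fourierMul_two_smul_pairIn (a : Latt d) :
    fourierMul ((2 : ℂ) • pairIn (a, a))
      = (modeShift 1 + modeShift (-1)) * mapModes (siteMul a) := by
  have h : ∀ k, toL1 ((2 : ℂ) • pairIn (a, a)) k = pairIn (a, a) k := fun k => by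
    rw [toL1_apply, ← unweight_apply, unweight_two_smul_pairIn]
  rw [fourierMul, ContinuousLinearMap.comp_apply, modeConv_eq_tsum]
  simp_rw [h]
  rw [tsum_eq_sum (s := {1, -1}) fun k hk => ?_, Finset.sum_pair (by norm_num), pairIn_one,
    pairIn_neg_one, mulMode_eq, mulMode_eq, add_mul]
  rw [pairIn_far _ (by simpa using hk), map_zero]

/-- Binomial theorem for (e^{iτ} + e^{-iτ})^N; the two shifts commute. -/
theorem modeShift_add_pow_apply (N : ℕ) (F : Modes d) (m : ℤ) :
    (((modeShift 1 + modeShift (-1)) ^ N : Modes d →L[ℂ] Modes d) F) m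
      = ∑ j ∈ Finset.range (N + 1), (N.choose j : ℂ) • F (m - (2 * j - N)) := by
  have hc : Commute (modeShift 1 : Modes d →L[ℂ] Modes d) (modeShift (-1)) := by
    rw [Commute, SemiconjBy, modeShift_mul, modeShift_mul, add_comm]
  rw [hc.add_pow, sum_apply, lp.coeFn_sum, Finset.sum_apply]
  refine Finset.sum_congr rfl fun j hj => ?_
  rw [modeShift_pow, modeShift_pow, modeShift_mul, ← nsmul_eq_mul', ← Nat.cast_smul_eq_nsmul ℂ,
    smul_apply, lp.coeFn_smul, Pi.smul_apply, modeShift_apply]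
  have : j ≤ N := Nat.lt_succ_iff.mp (Finset.mem_range.mp hj)
  rw [show (j : ℤ) * 1 + ((N - j : ℕ) : ℤ) * -1 = 2 * j - N by push_cast [this]; ring]

theorem fourierMul_pow_two_smul_pairIn {a : Latt d} (ha : ∀ n, (a n).im = 0) (p : ℕ) :
    fourierMul ((2 : ℂ) • pairIn (a, a)) ^ (2 * p)
      = (modeShift 1 + modeShift (-1)) ^ (2 * p) * mapModes (mulAbsPow a (2 * p)) := by
  rw [fourierMul_two_smul_pairIn, Commute.mul_pow, ← mapModes_pow, siteMul_pow_eq_mulAbsPow ha]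
  exact (modeShift_comm_mapModes _ _).add_left (modeShift_comm_mapModes _ _)

theorem modeShift_add_pow_pairIn_one (p : ℕ) (z : Latt d × Latt d) :
    (((modeShift 1 + modeShift (-1)) ^ (2 * p) : Modes d →L[ℂ] Modes d) (pairIn z)) 1
      = ((2 * p).choose p : ℂ) • z.1 + ((2 * p).choose (p + 1) : ℂ) • z.2 := by
  have h1 : ∀ j : ℕ, (1 - (2 * (j : ℤ) - (2 * p : ℕ)) = 1) ↔ j = p := fun j => by omega
  have h2 : ∀ j : ℕ, (1 - (2 * (j : ℤ) - (2 * p : ℕ)) = -1) ↔ j = p + 1 := fun j => by omega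
  rw [modeShift_add_pow_apply]
  simp only [pairIn_apply, h1, h2, smul_add, smul_ite, smul_zero, Finset.sum_add_distrib,
    Finset.sum_ite_eq', Finset.mem_range]
  rw [if_pos (by omega)]
  congr 1
  -- The index p + 1 leaves the range of summation only when p = 0, and then the binomial
  -- coefficient vanishes.
  split_ifs with h
  · rfl
  · rw [Nat.choose_eq_zero_of_lt (by omega), Nat.cast_zero, zero_smul]

theorem modeShift_add_pow_pairIn_neg_one {p : ℕ} (hp : 1 ≤ p) (z : Latt d × Latt d) :
    (((modeShift 1 + modeShift (-1)) ^ (2 * p) : Modes d →L[ℂ] Modes d) (pairIn z)) (-1)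
      = ((2 * p).choose p : ℂ) • z.2 + ((2 * p).choose (p + 1) : ℂ) • z.1 := by
  -- The truncated subtraction p - 1 is the true index because p ≥ 1.
  have h1 : ∀ j : ℕ, (-1 - (2 * (j : ℤ) - (2 * p : ℕ)) = 1) ↔ j = p - 1 := fun j => by omega
  have h2 : ∀ j : ℕ, (-1 - (2 * (j : ℤ) - (2 * p : ℕ)) = -1) ↔ j = p := fun j => by omega
  have h3 : (2 * p).choose (p - 1) = (2 * p).choose (p + 1) :=
    Nat.choose_symm_of_eq_add (by omega)
  rw [modeShift_add_pow_apply]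
  simp only [pairIn_apply, h1, h2, smul_add, smul_ite, smul_zero, Finset.sum_add_distrib,
    Finset.sum_ite_eq', Finset.mem_range]
  rw [if_pos (by omega), if_pos (by omega), h3, add_comm]

/-- The operator of the spectral problem at `ε = 0`. -/
def baseOp (p : ℕ) (Ω : ℝ) (a : Latt d) (σ : ℂ) : Modes d →L[ℂ] Modes d :=
  kgOp 0 1 Ω σ ((1 + 2 * p : ℂ) • fourierMul ((2 : ℂ) • pairIn (a, a)) ^ (2 * p))

theorem baseOp_apply_far (p : ℕ) (Ω : ℝ) (a : Latt d) (σ : ℂ) (F : Modes d) {m : ℤ}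
    (hm : ¬(m = 1 ∨ m = -1)) : baseOp p Ω a σ F m = ((1 - (m : ℂ) ^ 2) * wt m) • F m := by
  rw [baseOp, kgOp_apply_far _ _ _ _ _ _ hm, zero_smul, zero_smul, add_zero, sub_zero, smul_smul]
  congr 1
  linear_combination (m : ℂ) ^ 2 * wt m * I_mul_I

theorem baseOp_pairIn {p : ℕ} (hp : 1 ≤ p) (Ω : ℝ) {a : Latt d} (ha : ∀ n, (a n).im = 0) (σ : ℂ)
    (z : Latt d × Latt d) :
    baseOp p Ω a σ ((2 : ℂ) • pairIn z) = pairIn (pairOp p Ω a σ z) := by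
  obtain ⟨x, y⟩ := z
  refine lp.ext (funext fun m => ?_)
  by_cases hm : m = 1 ∨ m = -1
  · rw [baseOp, kgOp_apply_near _ _ _ _ _ _ hm, ← unweight_apply, unweight_two_smul_pairIn,
      fourierMul_pow_two_smul_pairIn ha, smul_apply, mul_apply_eq_comp, mapModes_pairIn,
      lp.coeFn_smul, Pi.smul_apply, pairOp, add_apply, pairDiag_apply, pairPot_apply, alph, bet]
    rcases hm with rfl | rfl
    · rw [modeShift_add_pow_pairIn_one, pairIn_one, pairIn_one, Prod.fst_add]
      push_cast
      module
    · rw [modeShift_add_pow_pairIn_neg_one hp, pairIn_neg_one, pairIn_neg_one, Prod.snd_add]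
      push_cast
      module
  · rw [baseOp_apply_far _ _ _ _ _ hm, lp.coeFn_smul, Pi.smul_apply, pairIn_far _ hm,
      pairIn_far _ hm, smul_zero, smul_zero]

/-- The symbol of the inverse of the base operator on the modes other than `±1`. -/
def farInvSymbol (m : ℤ) : ℂ := if m = 1 ∨ m = -1 then 0 else ((1 - (m : ℂ) ^ 2) * wt m)⁻¹

theorem one_sub_sq_ne_zero {m : ℤ} (hm : ¬(m = 1 ∨ m = -1)) : (1 - (m : ℂ) ^ 2) ≠ 0 := by
  intro h
  have h' : (m : ℤ) ^ 2 = 1 := by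
    have : (m : ℂ) ^ 2 = 1 := by linear_combination -h
    exact_mod_cast this
  exact hm (mul_self_eq_one_iff.mp (by rw [← pow_two, h']))

/-- The ratio (1 + m²)/|1 - m²| equals 1 at m = 0 and is at most 5/3 for |m| ≥ 2. -/
theorem norm_farInvSymbol_le (m : ℤ) : ‖farInvSymbol m‖ ≤ 2 := by
  rw [farInvSymbol]
  split_ifs with hm
  · simp
  · rw [mul_inv, norm_mul, wt, inv_inv]
    have e1 : (1 - (m : ℂ) ^ 2) = ((1 - (m : ℝ) ^ 2 : ℝ) : ℂ) := by push_cast; rfl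
    have e2 : (1 + (m : ℂ) ^ 2) = ((1 + (m : ℝ) ^ 2 : ℝ) : ℂ) := by push_cast; rfl
    rw [norm_inv, e1, e2, norm_real, norm_real, Real.norm_eq_abs, Real.norm_eq_abs,
      abs_of_nonneg (show (0 : ℝ) ≤ 1 + (m : ℝ) ^ 2 by positivity), inv_mul_eq_div]
    rcases eq_or_ne m 0 with rfl | h0
    · norm_num
    · have h4 : (4 : ℤ) ≤ m ^ 2 := by
        rw [not_or] at hm
        have : m ≤ -2 ∨ 2 ≤ m := by omega
        rcases this with h | h <;> nlinarith
      have h4' : (4 : ℝ) ≤ (m : ℝ) ^ 2 := by exact_mod_cast h4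
      rw [abs_of_neg (by linarith), div_le_iff₀ (by linarith)]
      linarith

/-- The operator is block triangular: the far modes decouple into an invertible diagonal, though
they may feed into the modes ±1. What remains is `pairOp + K`, to which the Fredholm alternative
applies. The compact K is `oddCorrection` for breathers and a rank-one operator for eigenvalues. -/
theorem bijective_baseOp_add {p : ℕ} (hp : 1 ≤ p) {Ω : ℝ} {a : Latt d} (ha : ∀ n, (a n).im = 0)
    {σ : ℂ} (hσ : σ.re = 0) (h1 : Ω - 2 * σ.im ∉ Set.Icc (-(4 * d : ℝ)) 0)
    (h2 : Ω + 2 * σ.im ∉ Set.Icc (-(4 * d : ℝ)) 0)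
    {K : (Latt d × Latt d) →L[ℂ] (Latt d × Latt d)} (hK : IsCompactOperator K)
    (hinj : ∀ z, pairOp p Ω a σ z + K z = 0 → z = 0) :
    Function.Bijective (baseOp p Ω a σ + pairIn.comp (K.comp pairOut)) := by
  set D := baseOp p Ω a σ + pairIn.comp (K.comp pairOut) with hD
  have hfar : ∀ (F : Modes d) (m : ℤ), ¬(m = 1 ∨ m = -1) →
      D F m = ((1 - (m : ℂ) ^ 2) * wt m) • F m := fun F m hm => by
    rw [hD, add_apply, lp.coeFn_add, Pi.add_apply, baseOp_apply_far _ _ _ _ _ hm,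
      ContinuousLinearMap.comp_apply, pairIn_far _ hm, add_zero]
  have hne : ∀ m : ℤ, ¬(m = 1 ∨ m = -1) → (1 - (m : ℂ) ^ 2) * wt m ≠ 0 := fun m hm =>
    mul_ne_zero (one_sub_sq_ne_zero hm) (inv_ne_zero (one_add_sq_ne_zero m))
  have hpair : ∀ z, D ((2 : ℂ) • pairIn z) = pairIn (pairOp p Ω a σ z + K z) := fun z => by
    rw [hD, add_apply, baseOp_pairIn hp Ω ha, ContinuousLinearMap.comp_apply,
      ContinuousLinearMap.comp_apply, pairOut_two_smul_pairIn, map_add]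
  constructor
  · rw [injective_iff_map_eq_zero]
    intro F hF
    have hF0 : F = (2 : ℂ) • pairIn ((1 / 2 : ℂ) • (F 1, F (-1))) := by
      rw [map_smul, smul_smul, show (2 : ℂ) * (1 / 2) = 1 by norm_num, one_smul]
      refine eq_pairIn fun m hm => ?_
      have := hfar F m hm
      rw [hF] at this
      exact (smul_eq_zero_iff_right (hne m hm)).mp this.symm
    have h := hpair ((1 / 2 : ℂ) • (F 1, F (-1)))
    rw [← hF0, hF] at h
    have hz : pairOp p Ω a σ ((1 / 2 : ℂ) • (F 1, F (-1)))
        + K ((1 / 2 : ℂ) • (F 1, F (-1))) = 0 := by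
      refine Prod.ext ?_ ?_
      · rw [← pairIn_one, ← h]; rfl
      · rw [← pairIn_neg_one, ← h]; rfl
    rw [hF0, hinj _ hz, map_zero, smul_zero]
  · intro Y
    -- Solve the far equations first; the residual is then supported on the modes ±1.
    let G : Modes d := multiplier farInvSymbol norm_farInvSymbol_le Y
    have hG : ∀ m, ¬(m = 1 ∨ m = -1) → (Y - D G) m = 0 := fun m hm => by
      rw [lp.coeFn_sub, Pi.sub_apply, hfar G m hm, multiplier_apply, farInvSymbol, if_neg hm,
        smul_smul, mul_inv_cancel₀ (hne m hm), one_smul, sub_self]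
    have hu : IsUnit (pairOp p Ω a σ + K) := by
      rw [pairOp, add_assoc]
      refine isUnit_add_of_isCompactOperator (isUnit_pairDiag hσ h1 h2)
        ((isCompactOperator_pairPot (isCompactOperator_mulAbsPow ha hp) _ _).add hK) fun z hz => ?_
      refine hinj z ?_
      rw [← hz, pairOp, add_apply, add_apply, add_assoc]
    obtain ⟨z, hz⟩ := (ContinuousLinearMap.isUnit_iff_bijective.mp hu).2
      ((Y - D G) 1, (Y - D G) (-1))
    refine ⟨G + (2 : ℂ) • pairIn z, ?_⟩
    rw [map_add, hpair, ← add_apply, hz, ← eq_pairIn hG, add_sub_cancel]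

/-! ### Analytic implicit functions and analyticity of the operator. -/

theorem exists_analytic_implicit {P X Y : Type*} [NormedAddCommGroup P] [NormedSpace ℂ P]
    [CompleteSpace P] [NormedAddCommGroup X] [NormedSpace ℂ X] [CompleteSpace X]
    [NormedAddCommGroup Y] [NormedSpace ℂ Y] [CompleteSpace Y] {f : P × X → Y} {p₀ : P} {x₀ : X}
    (hf : AnalyticAt ℂ f (p₀, x₀)) (h0 : f (p₀, x₀) = 0) {D : X →L[ℂ] Y}
    (hD : HasFDerivAt (fun x => f (p₀, x)) D x₀) (hbij : Function.Bijective D) :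
    ∃ φ : P → X, AnalyticAt ℂ φ p₀ ∧ φ p₀ = x₀ ∧
      ∀ᶠ v in 𝓝 (p₀, x₀), f v = 0 ↔ φ v.1 = v.2 := by
  -- The top regularity class is analyticity, so the implicit function is obtained as an analytic
  -- map.
  have cdf : ContDiffAt ℂ ⊤ f (p₀, x₀) := hf.contDiffAt
  have heq : (fderiv ℂ f (p₀, x₀)).comp (ContinuousLinearMap.inr ℂ P X) = D :=
    (hf.differentiableAt.hasFDerivAt.comp x₀ (hasFDerivAt_prodMk_right p₀ x₀)).unique hD
  have hinv : ((fderiv ℂ f (p₀, x₀)).comp (ContinuousLinearMap.inr ℂ P X)).IsInvertible := by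
    rw [heq]
    exact ⟨ContinuousLinearEquiv.ofBijective D (LinearMap.ker_eq_bot.mpr hbij.1)
      (LinearMap.range_eq_top.mpr hbij.2), ContinuousLinearEquiv.coe_ofBijective _ _ _⟩
  refine ⟨cdf.implicitFunction (by simp) hinv,
    (cdf.contDiffAt_implicitFunction (by simp) hinv).analyticAt,
    cdf.implicitFunction_apply_self (by simp) hinv, ?_⟩
  filter_upwards [cdf.eventually_apply_eq_iff_implicitFunction (by simp) hinv] with v hv
  rw [← hv, h0]

theorem analyticAt_kgOp {X : Type*} [NormedAddCommGroup X] [NormedSpace ℂ X]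
    {ε ω θ σ : X → ℂ} {V : X → Modes d →L[ℂ] Modes d} {x : X} (hε : AnalyticAt ℂ ε x)
    (hω : AnalyticAt ℂ ω x) (hθ : AnalyticAt ℂ θ x) (hσ : AnalyticAt ℂ σ x)
    (hV : AnalyticAt ℂ V x) :
    AnalyticAt ℂ (fun y => kgOp (ε y) (ω y) (θ y) (σ y) (V y)) x := by
  have hVL : AnalyticAt ℂ (fun y => (V y - mapModes (lap d)) * unweight) x :=
    (hV.sub analyticAt_const).mul analyticAt_const
  have hs : ∀ {c : X → ℂ}, AnalyticAt ℂ c x → ∀ K : Modes d →L[ℂ] Modes d,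
      AnalyticAt ℂ (fun y => c y • K) x := fun hc _ => hc.smul analyticAt_const
  unfold kgOp
  refine (analyticAt_const.mul ?_).add (analyticAt_const.mul ?_)
  · refine ((AnalyticAt.add ?_ ?_).sub ?_).add (hε.smul hVL)
    · exact hs (by fun_prop) _
    · exact hs (by fun_prop) _
    · exact hs (by fun_prop) _
  · refine (AnalyticAt.add ?_ ?_).add hVL
    · exact hs (by fun_prop) _
    · exact hs (by fun_prop) _

/-- At σ = 0 the term linear in m disappears. The symbol is even in m, which gives the reflection
symmetry, and it is real for real parameters, which gives the conjugation symmetry. -/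
theorem kgOp_apply_zero (ε ω θ : ℂ) (V : Modes d →L[ℂ] Modes d) (F : Modes d) (m : ℤ) :
    kgOp ε ω θ 0 V F m
      = (if m = 1 ∨ m = -1 then θ else 1 - (m : ℂ) ^ 2 * ω ^ 2) • wt m • F m
        + (if m = 1 ∨ m = -1 then 1 else ε) • (V (unweight F) m - lap d (wt m • F m)) := by
  split_ifs with hm
  · rw [kgOp_apply_near _ _ _ _ _ _ hm]
    module
  · rw [kgOp_apply_far _ _ _ _ _ _ hm]
    have : (1 + (ε * 0 + I * m * ω) ^ 2 : ℂ) = 1 - (m : ℂ) ^ 2 * ω ^ 2 := by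
      linear_combination (m : ℂ) ^ 2 * ω ^ 2 * I_mul_I
    rw [this]
    module

/-- Undoes the division by ε in the modes ±1: there m² = 1, and 1 + (εσ + imω)² is exactly ε(θ + εσ²
+ 2iωσm). -/
theorem kgOp_eq_zero_iff {ε ω θ σ : ℂ} (hε : ε ≠ 0) (hθ : ε * θ = 1 - ω ^ 2)
    (V : Modes d →L[ℂ] Modes d) (F : Modes d) :
    kgOp ε ω θ σ V F = 0 ↔ ∀ m : ℤ, (1 + (ε * σ + I * m * ω) ^ 2) • wt m • F m
      + ε • V (unweight F) m - ε • lap d (wt m • F m) = 0 := by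
  have key : ∀ m : ℤ, kgOp ε ω θ σ V F m = 0 ↔ (1 + (ε * σ + I * m * ω) ^ 2) • wt m • F m
      + ε • V (unweight F) m - ε • lap d (wt m • F m) = 0 := fun m => by
    by_cases hm : m = 1 ∨ m = -1
    · have hm2 : (m : ℂ) ^ 2 = 1 := by
        rcases hm with rfl | rfl <;> norm_num
      rw [kgOp_apply_near _ _ _ _ _ _ hm, ← smul_eq_zero_iff_right hε]
      have : (1 + (ε * σ + I * m * ω) ^ 2 : ℂ)
          = ε * (θ + ε * σ ^ 2 + 2 * I * ω * σ * m) := by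
        linear_combination (-1 : ℂ) * hθ - ω ^ 2 * hm2 + (m : ℂ) ^ 2 * ω ^ 2 * I_mul_I
      rw [this]
      have h2 : ∀ x y z : Latt d, ε • ((θ + ε * σ ^ 2 + 2 * I * ω * σ * m) • x + y - z)
          = (ε * (θ + ε * σ ^ 2 + 2 * I * ω * σ * m)) • x + ε • y - ε • z := fun x y z => by
        module
      rw [h2]
    · rw [kgOp_apply_far _ _ _ _ _ _ hm]
  simp_rw [← key]
  exact ⟨fun h m => by rw [h]; rfl, fun h => lp.ext (funext h)⟩

/-! ### Invariance under reflection of the Fourier index and complex conjugation. -/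

section Symmetry

/-- The reflection `m ↦ -m` of the Fourier index. -/
def reflect : Modes d →L[ℂ] Modes d := reindex (Equiv.neg ℤ)

@[simp]
theorem reflect_apply (F : Modes d) (m : ℤ) : reflect F m = F (-m) := rfl

theorem wt_neg (m : ℤ) : wt (-m) = wt m := by
  rw [wt, wt]
  push_cast
  rw [neg_sq]

theorem star_wt (m : ℤ) : star (wt m) = wt m := by
  rw [wt, star_inv₀]
  simp

theorem unweight_reflect (F : Modes d) : unweight (reflect F) = reflect (unweight F) := by
  refine lp.ext (funext fun m => ?_)
  simp [wt_neg]

theorem unweight_star (F : Modes d) : unweight (star F) = star (unweight F) := by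
  refine lp.ext (funext fun m => ?_)
  rw [lp.star_apply, unweight_apply, unweight_apply, lp.star_apply, star_smul, star_wt]

theorem fourierMul_reflect (F G : Modes d) :
    fourierMul (reflect F) (reflect G) = reflect (fourierMul F G) := by
  refine Modes.ext' fun m n => ?_
  rw [reflect_apply, fourierMul_apply, fourierMul_apply, ← (Equiv.neg ℤ).tsum_eq]
  refine tsum_congr fun k => ?_
  rw [Equiv.neg_apply, wt_neg, reflect_apply, reflect_apply, neg_neg,
    show -(m - -k) = -m - k by ring]

theorem fourierMul_star (F G : Modes d) :
    fourierMul (star F) (star G) = star (fourierMul F G) := by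
  refine Modes.ext' fun m n => ?_
  rw [lp.star_apply, lp.star_apply, fourierMul_apply, fourierMul_apply, tsum_star]
  refine tsum_congr fun k => ?_
  simp only [lp.star_apply, star_mul', star_wt]

theorem fourierMul_pow_reflect (F G : Modes d) (j : ℕ) :
    (fourierMul (reflect F) ^ j) (reflect G) = reflect ((fourierMul F ^ j) G) := by
  induction j with
  | zero => rfl
  | succ j ih => rw [fourierMul_pow_succ_apply, fourierMul_pow_succ_apply, ih, fourierMul_reflect]

theorem fourierMul_pow_star (F G : Modes d) (j : ℕ) :
    (fourierMul (star F) ^ j) (star G) = star ((fourierMul F ^ j) G) := by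
  induction j with
  | zero => rfl
  | succ j ih => rw [fourierMul_pow_succ_apply, fourierMul_pow_succ_apply, ih, fourierMul_star]

theorem shift_star (v : Fin d → ℤ) (u : Latt d) : shift v (star u) = star (shift v u) := rfl

theorem lap_star (u : Latt d) : lap d (star u) = star (lap d u) := by
  simp only [lap, sum_apply, sub_apply, add_apply, smul_apply, shift_star, star_sum, star_sub,
    star_add, star_smul, ContinuousLinearMap.id_apply]
  simp

theorem mulAbsPow_star (a u : Latt d) (k : ℕ) :
    mulAbsPow a k (star u) = star (mulAbsPow a k u) := by
  refine lp.ext (funext fun n => ?_)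
  simp

theorem kgOp_reflect (ε ω θ : ℂ) (F G : Modes d) (j : ℕ) :
    kgOp ε ω θ 0 (fourierMul (reflect F) ^ j) (reflect G)
      = reflect (kgOp ε ω θ 0 (fourierMul F ^ j) G) := by
  refine lp.ext (funext fun m => ?_)
  have hm : (-m = 1 ∨ -m = -1) ↔ (m = 1 ∨ m = -1) := by omega
  rw [reflect_apply, kgOp_apply_zero, kgOp_apply_zero, unweight_reflect, fourierMul_pow_reflect,
    reflect_apply, reflect_apply, wt_neg]
  simp only [hm, Int.cast_neg, neg_sq]

theorem kgOp_star (ε ω θ : ℝ) (F G : Modes d) (j : ℕ) :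
    kgOp ε ω θ 0 (fourierMul (star F) ^ j) (star G)
      = star (kgOp ε ω θ 0 (fourierMul F ^ j) G) := by
  refine lp.ext (funext fun m => ?_)
  rw [lp.star_apply, kgOp_apply_zero, kgOp_apply_zero, unweight_star, fourierMul_pow_star,
    lp.star_apply, lp.star_apply, star_add, star_smul, star_smul, star_smul, star_sub, ← lap_star,
    star_smul, star_wt]
  split_ifs <;> simp

end Symmetry

/-! ### Existence of a breather branch. -/

/-- This is d(U^{j+1}) = (j+1)U^j dU. By commutativity, varying the multiplying factor or the
function acted on contributes the same term. -/
theorem hasFDerivAt_fourierMul_pow_unweight (F : Modes d) (j : ℕ) :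
    HasFDerivAt (fun G : Modes d => (fourierMul G ^ j) (unweight G))
      ((j + 1 : ℂ) • (fourierMul F ^ j * unweight)) F := by
  induction j with
  | zero =>
    have : ((0 : ℕ) + 1 : ℂ) • (fourierMul F ^ 0 * unweight) = unweight := by simp
    rw [this]
    exact unweight.hasFDerivAt
  | succ j ih =>
    have h := (fourierMul (d := d)).hasFDerivAt (x := F) |>.clm_apply ih
    simp_rw [fourierMul_pow_succ_apply]
    refine h.congr_fderiv ?_
    ext1 G
    have e1 : fourierMul G ((fourierMul F ^ j) (unweight F))
        = (fourierMul F ^ (j + 1)) (unweight G) := by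
      rw [← mul_apply_eq_comp, ((fourierMul_commute G F).pow_right j).eq, mul_apply_eq_comp,
        fourierMul_unweight_comm, pow_succ, mul_apply_eq_comp]
    have e2 : fourierMul F ((fourierMul F ^ j) (unweight G))
        = (fourierMul F ^ (j + 1)) (unweight G) := (fourierMul_pow_succ_apply _ _ _).symm
    simp only [add_apply, ContinuousLinearMap.comp_apply, ContinuousLinearMap.flip_apply,
      smul_apply, mul_apply_eq_comp, map_smul, e1, e2]
    push_cast
    module

/-- The compact correction that removes the kernel of the linearisation on odd sequences. -/
def oddCorrection (p : ℕ) (a : Latt d) : (Latt d × Latt d) →L[ℂ] (Latt d × Latt d) :=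
  pairPot (mulAbsPow a (2 * p)) (-(gam p : ℂ) / 2) ((gam p : ℂ) / 2)

theorem oddCorrection_apply (p : ℕ) (a x y : Latt d) :
    oddCorrection p a (x, y) = (((gam p : ℂ) / 2) • mulAbsPow a (2 * p) (y - x),
      ((gam p : ℂ) / 2) • mulAbsPow a (2 * p) (x - y)) := by
  rw [oddCorrection, pairPot_apply, map_sub, map_sub]
  refine Prod.ext ?_ ?_
  · dsimp only
    module
  · dsimp only
    module

/-- In the variables (b₊, b₋) the correction cancels the potential in front of b₋. The system
becomes J_Ω b₊ = 0 and (Ω - Δ)b₋ = 0, both with trivial kernel. -/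
theorem pairOp_add_oddCorrection_injective {p : ℕ} {Ω : ℝ} {a : Latt d}
    (hΩ : Ω ∉ Set.Icc (-(4 * d : ℝ)) 0) (hJ : ∀ v : Latt d, jac p Ω a v = 0 → v = 0)
    (z : Latt d × Latt d) (hz : pairOp p Ω a 0 z + oddCorrection p a z = 0) : z = 0 := by
  obtain ⟨⟨b₁, b₂⟩, rfl⟩ := exists_polarize_eq z
  have h : copolarize (linNLS p Ω a (b₁, b₂) + ((gam p : ℂ) • mulAbsPow a (2 * p) b₂, 0)) = 0 := by
    rw [← hz, pairOp_polarize, mul_zero, zero_smul, sub_zero, polarize, oddCorrection_apply]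
    simp only [map_add, map_sub, map_smul, copolarize]
    refine Prod.ext ?_ ?_
    · simp only [Prod.fst_add, Prod.snd_add]
      module
    · simp only [Prod.fst_add, Prod.snd_add]
      module
  have h' := copolarize_eq_zero h
  have hs : schr p Ω 1 a b₂ = ((Ω : ℂ) • (1 : Latt d →L[ℂ] Latt d) - lap d) b₂
      + (gam p : ℂ) • mulAbsPow a (2 * p) b₂ := by
    rw [schr, one_mul]
    rfl
  have h1 : -(schr p Ω 1 a b₂) + (gam p : ℂ) • mulAbsPow a (2 * p) b₂ = 0 := congrArg Prod.fst h'
  have h2 : jac p Ω a b₁ + 0 = 0 := congrArg Prod.snd h'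
  have hb₁ : b₁ = 0 := hJ b₁ (by rw [← h2, add_zero])
  have hb₂ : b₂ = 0 := by
    refine (ContinuousLinearMap.isUnit_iff_bijective.mp (isUnit_smul_one_sub_lap hΩ)).1 ?_
    rw [map_zero]
    rw [hs] at h1
    rw [← neg_eq_zero, ← h1]
    abel
  rw [hb₁, hb₂]
  simp [polarize]

theorem analyticAt_clm_apply {X Y Z : Type*} [NormedAddCommGroup X] [NormedSpace ℂ X]
    [NormedAddCommGroup Y] [NormedSpace ℂ Y] [NormedAddCommGroup Z] [NormedSpace ℂ Z]
    {f : X → Y →L[ℂ] Z} {g : X → Y} {x : X} (hf : AnalyticAt ℂ f x) (hg : AnalyticAt ℂ g x) :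
    AnalyticAt ℂ (fun y => f y (g y)) x :=
  AnalyticAt.comp (g := fun q : (Y →L[ℂ] Z) × Y => q.1 q.2) (f := fun y => (f y, g y))
    (ContinuousLinearMap.analyticAt_bilinear (ContinuousLinearMap.id ℂ (Y →L[ℂ] Z)) (f x, g x))
    (hf.prod hg)

/-- The map whose zeros near the soliton are the even breathers. -/
def breatherMap (p : ℕ) (Ω : ℝ) (a : Latt d) (v : (ℂ × ℂ) × Modes d) : Modes d :=
  kgOp v.1.1 v.1.2 Ω 0 (fourierMul v.2 ^ (2 * p)) v.2
    + pairIn (oddCorrection p a (pairOut v.2))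

theorem analyticAt_breatherMap (p : ℕ) (Ω : ℝ) (a : Latt d) (v : (ℂ × ℂ) × Modes d) :
    AnalyticAt ℂ (breatherMap p Ω a) v := by
  have h2 : AnalyticAt ℂ (fun w : (ℂ × ℂ) × Modes d => w.2) v := analyticAt_snd
  have hM : AnalyticAt ℂ (fun w : (ℂ × ℂ) × Modes d => fourierMul w.2 ^ (2 * p)) v :=
    (((fourierMul (d := d)).analyticAt _).comp h2).pow _
  have hT := analyticAt_kgOp (ε := fun w : (ℂ × ℂ) × Modes d => w.1.1) (ω := fun w => w.1.2)
    (θ := fun _ => (Ω : ℂ)) (σ := fun _ => 0) (analyticAt_fst.comp analyticAt_fst)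
    (analyticAt_snd.comp analyticAt_fst) analyticAt_const analyticAt_const hM
  have hB := analyticAt_clm_apply hT h2
  have hK : AnalyticAt ℂ
      (fun w : (ℂ × ℂ) × Modes d => pairIn (oddCorrection p a (pairOut w.2))) v :=
    ((pairIn.comp ((oddCorrection p a).comp pairOut)).analyticAt _).comp h2
  exact hB.add hK

/-- At ε = 0 the potential acts only through the modes ±1, so the whole nonlinearity sits in one
term that can be differentiated separately. -/
theorem kgOp_zero_eq (Ω : ℝ) (V : Modes d →L[ℂ] Modes d) :
    kgOp 0 1 Ω 0 V = kgOp 0 1 Ω 0 0 + near * (V * unweight) := by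
  simp only [kgOp, zero_smul, zero_sub, sub_mul, neg_mul, add_zero, mul_add, mul_sub, mul_neg]
  abel

theorem hasFDerivAt_breatherMap (p : ℕ) (Ω : ℝ) (a : Latt d) :
    HasFDerivAt (fun F => breatherMap p Ω a ((0, 1), F))
      (baseOp p Ω a 0 + pairIn.comp ((oddCorrection p a).comp pairOut))
      ((2 : ℂ) • pairIn (a, a)) := by
  have h1 := (near (d := d)).hasFDerivAt.comp _
    (hasFDerivAt_fourierMul_pow_unweight ((2 : ℂ) • pairIn (a, a)) (2 * p))
  have h2 := (((kgOp 0 1 Ω 0 0 : Modes d →L[ℂ] Modes d).hasFDerivAt.add h1).add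
    (pairIn.comp ((oddCorrection p a).comp pairOut)).hasFDerivAt)
  refine (h2.congr_fderiv ?_).congr_of_eventuallyEq (Eventually.of_forall fun F => ?_)
  · congr 1
    rw [baseOp, kgOp_zero_eq Ω (_ • _), smul_mul_assoc]
    congr 1
    push_cast
    rw [add_comm (2 * (p : ℂ)) 1]
    rfl
  · change kgOp 0 1 Ω 0 (fourierMul F ^ (2 * p)) F + _ = _
    rw [kgOp_zero_eq]
    rfl

/-- The coefficient of e^{±iτ} in (2a cos τ)^{2p+1} is γ_p a^{2p+1}, so the modes ±1 carry the
stationary dNLS equation. -/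
theorem breatherMap_base {p : ℕ} (hp : 1 ≤ p) {Ω : ℝ} {a : Latt d} (ha : IsSoliton p Ω a) :
    breatherMap p Ω a ((0, 1), (2 : ℂ) • pairIn (a, a)) = 0 := by
  have hγ : ((2 * p).choose p : ℂ) + ((2 * p).choose (p + 1) : ℂ) = gam p := by
    rw [gam, add_comm 1 (2 * p), add_comm 1 p, Nat.choose_succ_succ]
    push_cast
    ring
  have hsol : (Ω : ℂ) • a + (((2 * p).choose p : ℂ) • mulAbsPow a (2 * p) a
      + ((2 * p).choose (p + 1) : ℂ) • mulAbsPow a (2 * p) a) - lap d a = 0 := by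
    rw [← add_smul, hγ, ha.2, sub_self]
  have hK : oddCorrection p a (a, a) = 0 := by
    rw [oddCorrection_apply, sub_self, map_zero, smul_zero]
    rfl
  change kgOp 0 1 Ω 0 (fourierMul ((2 : ℂ) • pairIn (a, a)) ^ (2 * p)) ((2 : ℂ) • pairIn (a, a))
    + pairIn (oddCorrection p a (pairOut ((2 : ℂ) • pairIn (a, a)))) = 0
  rw [pairOut_two_smul_pairIn, hK, map_zero, add_zero]
  refine lp.ext (funext fun m => ?_)
  rw [kgOp_apply_zero, ← unweight_apply, unweight_two_smul_pairIn,
    fourierMul_pow_two_smul_pairIn ha.1, mul_apply_eq_comp, mapModes_pairIn]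
  by_cases hm : m = 1 ∨ m = -1
  · rw [if_pos hm, if_pos hm, one_smul, ← add_sub_assoc]
    rcases hm with rfl | rfl
    · rw [modeShift_add_pow_pairIn_one, pairIn_one]
      exact hsol
    · rw [modeShift_add_pow_pairIn_neg_one hp, pairIn_neg_one]
      exact hsol
  · rw [if_neg hm, if_neg hm, zero_smul, add_zero, pairIn_far _ hm, smul_zero]
    rfl

theorem pairIn_reflect (z : Latt d × Latt d) : reflect (pairIn z) = pairIn (z.2, z.1) := by
  refine lp.ext (funext fun m => ?_)
  have h1 : -m = 1 ↔ m = -1 := by omega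
  have h2 : -m = -1 ↔ m = 1 := by omega
  rw [reflect_apply, pairIn_apply, pairIn_apply, add_comm]
  simp only [h1, h2]

theorem pairIn_star (z : Latt d × Latt d) : star (pairIn z) = pairIn (star z) := by
  refine lp.ext (funext fun m => ?_)
  rw [lp.star_apply, pairIn_apply, pairIn_apply, star_add]
  congr 1
  · split_ifs <;> simp
  · split_ifs <;> simp

theorem breatherMap_reflect (p : ℕ) (Ω : ℝ) (a : Latt d) (q : ℂ × ℂ) (F : Modes d) :
    breatherMap p Ω a (q, reflect F) = reflect (breatherMap p Ω a (q, F)) := by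
  rw [breatherMap, breatherMap, kgOp_reflect, map_add, pairIn_reflect, pairOut_apply,
    pairOut_apply, oddCorrection_apply, oddCorrection_apply, wt_one, wt_neg_one]
  rfl

theorem breatherMap_star (p : ℕ) (Ω : ℝ) (a : Latt d) (ε ω : ℝ) (F : Modes d) :
    breatherMap p Ω a (((ε : ℂ), (ω : ℂ)), star F)
      = star (breatherMap p Ω a (((ε : ℂ), (ω : ℂ)), F)) := by
  have hg : star ((gam p : ℂ) / 2) = (gam p : ℂ) / 2 := by simp
  have ho : star (oddCorrection p a (pairOut F)) = oddCorrection p a (pairOut (star F)) := by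
    rw [pairOut_apply, pairOut_apply, oddCorrection_apply, oddCorrection_apply, lp.star_apply,
      lp.star_apply]
    refine Prod.ext ?_ ?_
    · simp only [Prod.fst_star, star_smul, hg, ← mulAbsPow_star, star_sub, star_wt]
    · simp only [Prod.snd_star, star_smul, hg, ← mulAbsPow_star, star_sub, star_wt]
  rw [breatherMap, breatherMap, star_add, pairIn_star, ho]
  dsimp only
  rw [kgOp_star]

theorem tsum_shift_two_le {f : ℤ → ℝ} (hf : Summable f) (h0 : ∀ m, 0 ≤ f m) :
    ∑' m : ℕ, f (m + 2) ≤ ∑' m, f m :=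
  tsum_comp_le_tsum_of_inj hf h0 (i := fun m : ℕ => (m : ℤ) + 2) fun _ _ h => by simpa using h

theorem wtSum_nonneg : 0 ≤ wtSum := tsum_nonneg fun _ => norm_nonneg _

theorem norm_wt_smul_le (G : Modes d) (m : ℤ) : ‖wt m • G m‖ ≤ ‖G‖ := by
  rw [norm_smul]
  exact (mul_le_of_le_one_left (norm_nonneg _) (norm_wt_le m)).trans (norm_mode_le G m)

theorem tsum_norm_wt_shift_le (G : Modes d) :
    ∑' m : ℕ, ‖wt (m + 2) • G (m + 2)‖ ≤ wtSum * ‖G‖ :=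
  (tsum_shift_two_le (summable_norm_wt_smul G) fun _ => norm_nonneg _).trans
    (tsum_norm_wt_smul_le G)

theorem weighted_wt_smul (F : Modes d) (m : ℤ) : weighted (fun m => wt m • F m) m = F m := by
  rw [weighted, smul_smul, wt, mul_inv_cancel₀ (one_add_sq_ne_zero m), one_smul]

theorem memL22_wt_smul (F : Modes d) : MemL22 fun m => wt m • F m := by
  have : weighted (fun m => wt m • F m) = F := funext (weighted_wt_smul F)
  rw [MemL22, this]
  exact lp.memℓp F

/-- With σ = 0 and the potential U^{2p}, the linear operator applied to U itself is the nonlinear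
breather equation. -/
theorem isBreather_of_kgOp_eq_zero {p : ℕ} {ε ω θ : ℝ} (hε : ε ≠ 0) (hθ : ε * θ = 1 - ω ^ 2)
    {F : Modes d} (hF : kgOp ε ω θ 0 (fourierMul F ^ (2 * p)) F = 0) (heven : reflect F = F)
    (hreal : star F = F) : IsBreather p ε ω fun m => wt m • F m where
  mem := memL22_wt_smul F
  real m n := by
    have h : star (F m n) = F m n := by
      conv_rhs => rw [← hreal]
      rfl
    have h2 : star ((wt m • F m) n) = (wt m • F m) n := by
      change star (wt m * F m n) = wt m * F m n
      rw [star_mul', star_wt, h]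
    exact conj_eq_iff_im.mp h2
  even m := by
    rw [wt_neg]
    congr 1
    conv_rhs => rw [← heven]
    rfl
  eqn m n := by
    have h := (kgOp_eq_zero_iff (by exact_mod_cast hε) (by exact_mod_cast hθ) _ _).mp hF m
    have h' := congrArg (fun u : Latt d => u n) h
    have hpow : ∀ τ : ℝ, fourierSum (fun m => wt m • F m) n τ ^ (1 + 2 * p)
        = fourierSum (fun m => wt m • F m) n τ ^ (2 * p) * fourierSum (fun m => wt m • F m) n τ :=
      fun τ => by rw [add_comm, pow_succ]
    simp_rw [hpow]
    rw [integral_fourierSum_pow_mul]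
    change (1 + (ε * 0 + I * m * ω) ^ 2 : ℂ) * (wt m • F m) n
      + ε * (fourierMul F ^ (2 * p)) (unweight F) m n - ε * lap d (wt m • F m) n = 0 at h'
    have hpi : (Real.pi : ℂ) ≠ 0 := by exact_mod_cast Real.pi_ne_zero
    have hc : (ε : ℂ) / (2 * Real.pi) * (2 * Real.pi * (fourierMul F ^ (2 * p)) (unweight F) m n)
        = ε * (fourierMul F ^ (2 * p)) (unweight F) m n := by
      field_simp
    rw [hc]
    linear_combination h' - (m : ℂ) ^ 2 * ω ^ 2 * (wt m • F m) n * I_mul_I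

theorem exists_breatherBranch {p : ℕ} (hp : 1 ≤ p) {Ω : ℝ} (hΩ : Ω ∉ Set.Icc (-(4 * d : ℝ)) 0)
    {a : Latt d} (ha : IsSoliton p Ω a) (hJ : ∀ v : Latt d, jac p Ω a v = 0 → v = 0) :
    ∃ (ε₁ C₁ : ℝ) (ω : ℝ → ℝ) (A : ℝ → ℤ → Latt d), IsBreatherBranch p Ω a ε₁ C₁ ω A := by
  set F₀ : Modes d := (2 : ℂ) • pairIn (a, a) with hF₀
  obtain ⟨φ, hφ, hφ0, hiff⟩ := exists_analytic_implicit
    (analyticAt_breatherMap p Ω a ((0, 1), F₀)) (breatherMap_base hp ha)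
    (hasFDerivAt_breatherMap p Ω a)
    (bijective_baseOp_add hp ha.1 (σ := 0) rfl (by simpa using hΩ) (by simpa using hΩ)
      (isCompactOperator_pairPot (isCompactOperator_mulAbsPow ha.1 hp) _ _)
      (pairOp_add_oddCorrection_injective hΩ hJ))
  -- This choice makes (1 - ω²)/ε equal to Ω exactly, so that θ need not vary.
  let ω : ℝ → ℝ := fun ε => √(1 - ε * Ω)
  have hω : AnalyticAt ℝ ω 0 := by
    have h1 : AnalyticAt ℝ Real.sqrt (1 - 0 * Ω) :=
      (Real.contDiffAt_sqrt (by norm_num)).analyticAt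
    exact h1.comp (f := fun ε : ℝ => 1 - ε * Ω) (by fun_prop)
  let q : ℝ → ℂ × ℂ := fun ε => ((ε : ℂ), (ω ε : ℂ))
  have hq : AnalyticAt ℝ q 0 :=
    (Complex.ofRealCLM.analyticAt 0).prod ((Complex.ofRealCLM.analyticAt _).comp hω)
  have hq0 : q 0 = (0, 1) := by simp [q, ω]
  let Φ : ℝ → Modes d := fun ε => φ (q ε)
  have hΦ : AnalyticAt ℝ Φ 0 := by
    have h1 : AnalyticAt ℝ φ (q 0) := by
      rw [hq0]
      exact hφ.restrictScalars
    exact h1.comp hq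
  have hΦ0 : Φ 0 = F₀ := by rw [← hφ0, ← hq0]
  have hR0 : reflect F₀ = F₀ := by rw [hF₀, map_smul, pairIn_reflect]
  have hsa : star a = a := by
    refine lp.ext (funext fun n => ?_)
    exact conj_eq_iff_im.mpr (ha.1 n)
  have hS0 : star F₀ = F₀ := by
    rw [hF₀, star_smul, pairIn_star]
    have : star (a, a) = (a, a) := Prod.ext hsa hsa
    rw [this]
    simp
  -- The solution, its reflection and its conjugate all tend to the same base point, so local
  -- uniqueness in the implicit function theorem applies to each of them.
  have htend : ∀ s : Modes d → Modes d, Continuous s → s F₀ = F₀ →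
      Tendsto (fun ε => (q ε, s (Φ ε))) (𝓝 0) (𝓝 ((0, 1), F₀)) := fun s hs hs0 => by
    have h1 : Tendsto q (𝓝 0) (𝓝 (0, 1)) := hq0 ▸ hq.continuousAt
    have h2 : Tendsto (fun ε => s (Φ ε)) (𝓝 0) (𝓝 F₀) := by
      have := (hs.continuousAt (x := Φ 0)).tendsto.comp hΦ.continuousAt.tendsto
      rwa [hΦ0, hs0] at this
    exact h1.prodMk_nhds h2
  obtain ⟨C, hC⟩ := hΦ.differentiableAt.isBigO_sub.bound
  have hpos : ∀ᶠ ε : ℝ in 𝓝 0, 0 < 1 - ε * Ω := by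
    have : ContinuousAt (fun ε : ℝ => 1 - ε * Ω) 0 := by fun_prop
    exact this.eventually_const_lt (by norm_num)
  have hall := (((((hC.and hpos).and (hΦ.eventually_analyticAt.and hω.eventually_analyticAt)).and
    ((htend id continuous_id rfl).eventually hiff)).and
    ((htend reflect reflect.continuous hR0).eventually hiff)).and
    ((htend star continuous_star hS0).eventually hiff))
  obtain ⟨ε₁, hε₁, hball⟩ := Metric.eventually_nhds_iff.mp hall
  have hmem : ∀ ε ∈ Set.Ioo 0 ε₁, dist ε 0 < ε₁ := fun ε hε => by
    rw [Real.dist_eq, sub_zero, abs_of_pos hε.1]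
    exact hε.2
  refine ⟨ε₁, max ((2 + wtSum) * C) (Ω ^ 2 / 2), ω, fun ε m => wt m • Φ ε m, hε₁,
    ?_, ?_, ?_, ?_, ?_⟩
  · intro ε hε
    exact (hball (hmem ε hε)).1.1.1.2.2
  · refine ⟨Φ, fun ε hε => (hball (hmem ε hε)).1.1.1.2.1, fun ε _ m => ?_⟩
    exact (weighted_wt_smul (Φ ε) m).symm
  · intro ε hε
    obtain ⟨⟨⟨⟨⟨-, hp1⟩, -⟩, h1⟩, h2⟩, h3⟩ := hball (hmem ε hε)
    have hz : breatherMap p Ω a (q ε, Φ ε) = 0 := h1.mpr rfl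
    have hR : Φ ε = reflect (Φ ε) := h2.mp (by rw [breatherMap_reflect, hz, map_zero])
    have hS : Φ ε = star (Φ ε) := h3.mp (by rw [breatherMap_star, hz, star_zero])
    -- Evenness equates the two entries and makes the artificial term vanish; what remains is the
    -- true equation.
    have hodd : oddCorrection p a (pairOut (Φ ε)) = 0 := by
      have : Φ ε (-1) = Φ ε 1 := by
        conv_lhs => rw [hR]
        rfl
      rw [pairOut_apply, this, wt_one, wt_neg_one, oddCorrection_apply, sub_self, map_zero,
        smul_zero]
      rfl
    refine isBreather_of_kgOp_eq_zero (θ := Ω) hε.1.ne' ?_ ?_ hR.symm hS.symm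
    · rw [Real.sq_sqrt hp1.le]
      ring
    · rw [breatherMap, hodd, map_zero, add_zero] at hz
      exact hz
  · intro ε hε
    obtain ⟨⟨⟨⟨⟨-, hp1⟩, -⟩, -⟩, -⟩, -⟩ := hball (hmem ε hε)
    have hsq : ω ε ^ 2 = 1 - ε * Ω := Real.sq_sqrt hp1.le
    have h0 : 0 ≤ ω ε := Real.sqrt_nonneg _
    have e1 : ω ε - 1 + ε * Ω / 2 = -((ω ε - 1) ^ 2 / 2) := by
      linear_combination (1 / 2 : ℝ) * hsq
    have e2 : (ω ε - 1) ^ 2 * (ω ε + 1) ^ 2 = ε ^ 2 * Ω ^ 2 := by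
      have : (ω ε - 1) * (ω ε + 1) = -(ε * Ω) := by linear_combination hsq
      rw [← mul_pow, this]
      ring
    rw [e1, abs_neg, abs_of_nonneg (by positivity)]
    -- Follows from (ω - 1)(ω + 1) = -εΩ and ω + 1 ≥ 1.
    have e3 : (ω ε - 1) ^ 2 ≤ ε ^ 2 * Ω ^ 2 := by
      rw [← e2]
      exact le_mul_of_one_le_right (sq_nonneg _) (by nlinarith)
    have e4 : Ω ^ 2 / 2 ≤ max ((2 + wtSum) * C) (Ω ^ 2 / 2) := le_max_right _ _
    nlinarith [sq_nonneg ε]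
  · intro ε hε
    obtain ⟨⟨⟨⟨⟨hb, -⟩, -⟩, -⟩, -⟩, -⟩ := hball (hmem ε hε)
    rw [hΦ0, sub_zero, Real.norm_of_nonneg hε.1.le] at hb
    set G : Modes d := Φ ε - F₀ with hG
    have hF₀far : ∀ m : ℤ, ¬(m = 1 ∨ m = -1) → wt m • Φ ε m = wt m • G m := fun m hm => by
      rw [hG, lp.coeFn_sub, Pi.sub_apply, hF₀, lp.coeFn_smul, Pi.smul_apply, pairIn_far _ hm,
        smul_zero, sub_zero]
    have h1 : wt 1 • Φ ε 1 - a = wt 1 • G 1 := by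
      rw [hG, lp.coeFn_sub, Pi.sub_apply, hF₀, lp.coeFn_smul, Pi.smul_apply, pairIn_one,
        wt_one]
      module
    rw [h1, hF₀far 0 (by norm_num)]
    have h2 : ∀ m : ℕ, wt ((m : ℤ) + 2) • Φ ε ((m : ℤ) + 2) = wt ((m : ℤ) + 2) • G ((m : ℤ) + 2) :=
      fun m => hF₀far _ (by omega)
    simp_rw [h2]
    have h3 := tsum_norm_wt_shift_le G
    have h4 := norm_wt_smul_le G 0
    have h5 := norm_wt_smul_le G 1
    have h6 : (2 + wtSum) * ‖G‖ ≤ (2 + wtSum) * C * ε := by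
      rw [mul_assoc]
      exact mul_le_mul_of_nonneg_left hb (by linarith [wtSum_nonneg])
    have h7 : (2 + wtSum) * C * ε ≤ max ((2 + wtSum) * C) (Ω ^ 2 / 2) * ε :=
      mul_le_mul_of_nonneg_right (le_max_left _ _) hε.1.le
    linarith

/-! ### Continuation of a simple eigenvalue by bordering. -/

/-- Let T' = T + ℓ(·)r, invertible near the base point, and Y = T'⁻¹r. If T x = 0 then T'x = ℓ(x)r,
so x = ℓ(x)Y. Hence T has a nontrivial kernel exactly when ℓ(Y) = 1, and the kernel is then spanned
by Y. This scalar equation is solved for σ. -/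
theorem exists_analytic_eigenpair {P X : Type*} [NormedAddCommGroup P] [NormedSpace ℂ P]
    [CompleteSpace P] [NormedAddCommGroup X] [NormedSpace ℂ X] [CompleteSpace X]
    {T : P × ℂ → X →L[ℂ] X} {p₀ : P} {σ₀ : ℂ} {ℓ : X →L[ℂ] ℂ} {r x₀ : X}
    (hT : AnalyticAt ℂ T (p₀, σ₀)) (hx₀ : ℓ x₀ = 1)
    (hTx₀ : ∀ σ, T (p₀, σ) x₀ = (2 * (σ₀ - σ)) • r)
    (hbij : Function.Bijective (T (p₀, σ₀) + ℓ.smulRight r)) :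
    ∃ (s : P → ℂ) (ψ : P → X), AnalyticAt ℂ s p₀ ∧ AnalyticAt ℂ ψ p₀ ∧ s p₀ = σ₀ ∧ ψ p₀ = x₀ ∧
      (∀ᶠ q in 𝓝 p₀, T (q, s q) (ψ q) = 0 ∧ ψ q ≠ 0) ∧
      ∀ᶠ v in 𝓝 (p₀, σ₀), ∀ x, x ≠ 0 → T v x = 0 → v.2 = s v.1 ∧ ∃ c : ℂ, x = c • ψ v.1 := by
  let T' : P × ℂ → X →L[ℂ] X := fun v => T v + ℓ.smulRight r
  have hT' : AnalyticAt ℂ T' (p₀, σ₀) := hT.add analyticAt_const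
  have hunit : IsUnit (T' (p₀, σ₀)) := ContinuousLinearMap.isUnit_iff_bijective.mpr hbij
  have hunits : ∀ᶠ v in 𝓝 (p₀, σ₀), IsUnit (T' v) :=
    hT'.continuousAt.eventually (Units.isOpen.mem_nhds hunit)
  have hinv : AnalyticAt ℂ (fun v => Ring.inverse (T' v)) (p₀, σ₀) :=
    (analyticOnNhd_inverse (𝕜 := ℂ) (A := X →L[ℂ] X) _ hunit).comp hT'
  let Y : P × ℂ → X := fun v => Ring.inverse (T' v) r
  have hY : AnalyticAt ℂ Y (p₀, σ₀) := analyticAt_clm_apply hinv analyticAt_const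
  have hYr : ∀ v, IsUnit (T' v) → T' v (Y v) = r := fun v hv => by
    change (T' v * Ring.inverse (T' v)) r = r
    rw [Ring.mul_inverse_cancel _ hv]
    rfl
  have hYeq : ∀ v, IsUnit (T' v) → ∀ x (c : ℂ), T' v x = c • r → x = c • Y v := fun v hv x c h => by
    refine (ContinuousLinearMap.isUnit_iff_bijective.mp hv).1 ?_
    rw [h, map_smul, hYr v hv]
  have hbase : ∀ σ, T' (p₀, σ) x₀ = (1 + 2 * (σ₀ - σ)) • r := fun σ => by
    change T (p₀, σ) x₀ + ℓ x₀ • r = _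
    rw [hTx₀, hx₀, one_smul, add_smul, one_smul, add_comm]
  have hY0 : Y (p₀, σ₀) = x₀ := by
    have := hYeq _ hunit x₀ 1 (by rw [hbase]; simp)
    rw [this, one_smul]
  let e : P × ℂ → ℂ := fun v => ℓ (Y v) - 1
  have he : AnalyticAt ℂ e (p₀, σ₀) := ((ℓ.analyticAt _).comp hY).sub analyticAt_const
  have he0 : e (p₀, σ₀) = 0 := by simp only [e, hY0, hx₀, sub_self]
  -- At p₀ the vector Y is x₀ / (1 + 2(σ₀ - σ)), so e = 1/(1 + 2(σ₀ - σ)) - 1 explicitly.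
  have hederiv : HasDerivAt (fun σ => e (p₀, σ)) 2 σ₀ := by
    have h1 : HasDerivAt (fun σ : ℂ => 1 + 2 * (σ₀ - σ)) (-2) σ₀ := by
      have := (((hasDerivAt_id σ₀).const_sub σ₀).const_mul 2).const_add 1
      simpa using this
    have h2 : HasDerivAt (fun σ : ℂ => (1 + 2 * (σ₀ - σ))⁻¹ - 1) 2 σ₀ := by
      have := (h1.inv (by simp)).sub_const 1
      simpa using! this
    refine h2.congr_of_eventuallyEq ?_
    have hc : Tendsto (fun σ : ℂ => (p₀, σ)) (𝓝 σ₀) (𝓝 (p₀, σ₀)) :=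
      (Continuous.prodMk_right p₀).tendsto σ₀
    have hne : ∀ᶠ σ in 𝓝 σ₀, 1 + 2 * (σ₀ - σ) ≠ 0 :=
      h1.continuousAt.eventually_ne (by simp)
    filter_upwards [hc.eventually hunits, hne] with σ hσ hσ'
    have h3 := congrArg ℓ (hYeq _ hσ x₀ _ (hbase σ))
    rw [map_smul, hx₀, smul_eq_mul] at h3
    rw [eq_comm, inv_eq_of_mul_eq_one_right h3.symm]
  obtain ⟨s, hs, hs0, hiff⟩ := exists_analytic_implicit he he0 hederiv.hasFDerivAt (by
    refine (Function.bijective_iff_has_inverse).mpr ⟨fun y => y / 2, fun x => ?_, fun y => ?_⟩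
    · simp
    · simp)
  have hpair : AnalyticAt ℂ (fun q => (q, s q)) p₀ := analyticAt_id.prod hs
  have hpair0 : (p₀, s p₀) = (p₀, σ₀) := by rw [hs0]
  have htend : Tendsto (fun q => (q, s q)) (𝓝 p₀) (𝓝 (p₀, σ₀)) := by
    rw [← hpair0]
    exact hpair.continuousAt
  refine ⟨s, fun q => Y (q, s q), hs, ?_, hs0, ?_, ?_, ?_⟩
  · exact AnalyticAt.comp (g := Y) (f := fun q => (q, s q)) (by rw [hs0]; exact hY) hpair
  · change Y (p₀, s p₀) = x₀
    rw [hs0, hY0]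
  · filter_upwards [htend.eventually hunits, htend.eventually hiff] with q h1 h2
    have h3 : ℓ (Y (q, s q)) = 1 := sub_eq_zero.mp (h2.mpr rfl)
    have h4 : T (q, s q) (Y (q, s q)) + ℓ (Y (q, s q)) • r = r := hYr _ h1
    refine ⟨?_, fun h => ?_⟩
    · rwa [h3, one_smul, add_eq_right] at h4
    · rw [h, map_zero] at h3
      exact zero_ne_one h3
  · filter_upwards [hunits, hiff] with v h1 h2 x hx hTx
    have h3 : x = ℓ x • Y v := hYeq v h1 x _ (by
      change T v x + ℓ x • r = _
      rw [hTx, zero_add])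
    have h4 : ℓ x ≠ 0 := fun h => hx (by rw [h3, h, zero_smul])
    have h5 : e v = 0 := by
      have := congrArg ℓ h3
      rw [map_smul, smul_eq_mul] at this
      exact sub_eq_zero.mpr (mul_left_cancel₀ h4 (by rw [← this, mul_one]))
    have h6 : s v.1 = v.2 := h2.mp h5
    exact ⟨h6.symm, ℓ x, by rw [h6]; exact h3⟩

theorem polarize_smul (c : ℂ) (b : Latt d × Latt d) : polarize (c • b) = c • polarize b := by
  refine Prod.ext ?_ ?_
  · simp only [polarize, Prod.smul_fst, Prod.smul_snd]
    module
  · simp only [polarize, Prod.smul_fst, Prod.smul_snd]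
    module

theorem copolarize_add_smul (c : ℂ) (u v : Latt d × Latt d) :
    copolarize (u + c • v) = copolarize u + c • copolarize v := by
  refine Prod.ext ?_ ?_
  · simp only [copolarize, Prod.fst_add, Prod.snd_add, Prod.smul_fst, Prod.smul_snd]
    module
  · simp only [copolarize, Prod.fst_add, Prod.snd_add, Prod.smul_fst, Prod.smul_snd]
    module

theorem polarize_ne_zero {b : Latt d × Latt d} (hb : b ≠ 0) : polarize b ≠ 0 := by
  intro h
  apply hb
  have h1 : b.1 + I • b.2 = 0 := congrArg Prod.fst h
  have h2 : b.1 - I • b.2 = 0 := congrArg Prod.snd h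
  have h3 : (2 : ℂ) • b.1 = 0 := by
    rw [← add_zero (0 : Latt d), ← congrArg₂ (· + ·) h1 h2]
    module
  have h4 : b.1 = 0 := (smul_eq_zero_iff_right two_ne_zero).mp h3
  rw [h4, zero_add] at h1
  exact Prod.ext h4 ((smul_eq_zero_iff_right I_ne_zero).mp h1)

/-- Such a w satisfies (T - z)²w = 0, so it lies in the generalised eigenspace, which is the line
through b. -/
theorem IsSimpleIsolatedEigenvalue.eq_smul {X : Type*} [NormedAddCommGroup X] [NormedSpace ℂ X]
    {T : X →L[ℂ] X} {z : ℂ} (h : IsSimpleIsolatedEigenvalue T z) {b w : X} (hb0 : b ≠ 0)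
    (hb : T b = z • b) {t : ℂ} (hw : T w - z • w = t • b) : ∃ c : ℂ, w = c • b := by
  have hbm : b ∈ Module.End.maxGenEigenspace (T : X →ₗ[ℂ] X) z := by
    rw [Module.End.mem_maxGenEigenspace]
    refine ⟨1, ?_⟩
    rw [pow_one]
    exact sub_eq_zero.mpr hb
  have hwm : w ∈ Module.End.maxGenEigenspace (T : X →ₗ[ℂ] X) z := by
    rw [Module.End.mem_maxGenEigenspace]
    refine ⟨2, ?_⟩
    rw [pow_two]
    change (T (T w - z • w) - z • (T w - z • w)) = 0
    rw [hw, map_smul, hb, smul_comm, sub_self]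
  obtain ⟨c, hc⟩ := (finrank_eq_one_iff_of_nonzero'
    (⟨b, hbm⟩ : Module.End.maxGenEigenspace (T : X →ₗ[ℂ] X) z)
    (by simpa using hb0)).mp h.simple ⟨w, hwm⟩
  exact ⟨c, (congrArg Subtype.val hc).symm⟩

theorem isCompactOperator_smulRight {X : Type*} [NormedAddCommGroup X] [NormedSpace ℂ X]
    (ℓ : X →L[ℂ] ℂ) (r : X) : IsCompactOperator (ℓ.smulRight r) :=
  (isCompactOperator_of_locallyCompactSpace_rng
    (ContinuousLinearMap.toSpanSingleton ℂ r)).comp_clm ℓ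

/-- The equation reads (L - 2Λ)w = -ℓ(z)b with z = `polarize w`. Simplicity excludes a Jordan chain,
so w = cb, and the bordering term then gives c = 0. -/
theorem pairOp_add_smulRight_injective {p : ℕ} {Ω : ℝ} {a : Latt d} {Λ : ℂ}
    (hΛ : IsSimpleIsolatedEigenvalue (linNLS p Ω a) (2 * Λ)) {b : Latt d × Latt d} (hb0 : b ≠ 0)
    (hb : linNLS p Ω a b = (2 * Λ) • b) {ℓ : (Latt d × Latt d) →L[ℂ] ℂ} (hℓ : ℓ (polarize b) = 1)
    (z : Latt d × Latt d) (hz : pairOp p Ω a Λ z + ℓ.smulRight (copolarize b) z = 0) : z = 0 := by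
  obtain ⟨w, rfl⟩ := exists_polarize_eq z
  rw [pairOp_polarize, ContinuousLinearMap.smulRight_apply, ← copolarize_add_smul] at hz
  have h := copolarize_eq_zero hz
  obtain ⟨c, rfl⟩ := hΛ.eq_smul hb0 hb (t := -ℓ (polarize w)) (w := w) (by
    rw [neg_smul, ← add_eq_zero_iff_eq_neg]
    exact h)
  rw [map_smul, hb, smul_comm, sub_self, zero_add, polarize_smul, map_smul, hℓ] at h
  have hc : c = 0 := by simpa [hb0] using h
  rw [hc, polarize_smul, zero_smul]

/-! ### The spectral problem along a breather branch. -/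

/-- The parameters `(ε, ω, (1 - ω²) / ε, M)` of the spectral problem, where `M` is the operator of
multiplication by the breather. -/
abbrev Params (d : ℕ) : Type := ℂ × ℂ × ℂ × (Modes d →L[ℂ] Modes d)

/-- The operator of the spectral problem at the parameters `v.1` and the scaled eigenvalue
`v.2`. -/
def spectralOp (p : ℕ) (v : Params d × ℂ) : Modes d →L[ℂ] Modes d :=
  kgOp v.1.1 v.1.2.1 v.1.2.2.1 v.2 ((1 + 2 * p : ℂ) • v.1.2.2.2 ^ (2 * p))

theorem analyticAt_spectralOp (p : ℕ) (v : Params d × ℂ) : AnalyticAt ℂ (spectralOp p) v := by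
  have h1 : AnalyticAt ℂ (fun w : Params d × ℂ => w.1) v := analyticAt_fst
  have h2 : AnalyticAt ℂ (fun w : Params d × ℂ => w.1.2) v := analyticAt_snd.comp h1
  have h3 : AnalyticAt ℂ (fun w : Params d × ℂ => w.1.2.2) v := analyticAt_snd.comp h2
  have h4 : AnalyticAt ℂ (fun w : Params d × ℂ => w.1.2.2.2) v := analyticAt_snd.comp h3
  have h5 : AnalyticAt ℂ (fun w : Params d × ℂ => (1 + 2 * p : ℂ) • w.1.2.2.2 ^ (2 * p)) v := by
    have hc : AnalyticAt ℂ (fun _ : Params d × ℂ => (1 + 2 * p : ℂ)) v := analyticAt_const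
    exact hc.smul (h4.pow (2 * p))
  exact analyticAt_kgOp (analyticAt_fst.comp h1) (analyticAt_fst.comp h2) (analyticAt_fst.comp h3)
    analyticAt_snd h5

/-- The parameters in the limit `ε → 0`. -/
def baseParams (Ω : ℝ) (a : Latt d) : Params d :=
  (0, 1, (Ω : ℂ), fourierMul ((2 : ℂ) • pairIn (a, a)))

theorem spectralOp_base (p : ℕ) (Ω : ℝ) (a : Latt d) (σ : ℂ) :
    spectralOp p (baseParams Ω a, σ) = baseOp p Ω a σ := rfl

/-- The parameters at a breather. -/
def branchParams (ε ω : ℝ) (F : Modes d) : Params d :=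
  ((ε : ℂ), (ω : ℂ), (((1 - ω ^ 2) / ε : ℝ) : ℂ), fourierMul F)

theorem isEigenpair_iff {p : ℕ} {ε ω : ℝ} (hε : ε ≠ 0) {F₁ F : Modes d} {σ : ℂ} :
    IsEigenpair p ε ω (fun m => wt m • F₁ m) (ε * σ) (fun m => wt m • F m)
      ↔ F ≠ 0 ∧ spectralOp p (branchParams ε ω F₁, σ) F = 0 := by
  have hεc : (ε : ℂ) ≠ 0 := by exact_mod_cast hε
  have hθ : (ε : ℂ) * (((1 - ω ^ 2) / ε : ℝ) : ℂ) = 1 - (ω : ℂ) ^ 2 := by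
    push_cast
    field_simp
  have hpi : (Real.pi : ℂ) ≠ 0 := by exact_mod_cast Real.pi_ne_zero
  have hne : (fun m => wt m • F m) ≠ 0 ↔ F ≠ 0 := by
    refine not_congr ⟨fun h => lp.ext (funext fun m => ?_), fun h => ?_⟩
    · exact (smul_eq_zero_iff_right (inv_ne_zero (one_add_sq_ne_zero m))).mp (congrFun h m)
    · rw [h]
      exact funext fun m => smul_zero _
  have heq : (∀ (m : ℤ) (n : Fin d → ℤ), (1 + (ε * σ + I * m * ω) ^ 2) * (wt m • F m) n
      + (ε : ℂ) * (1 + 2 * p) / (2 * Real.pi) *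
        ∫ τ in (-Real.pi)..Real.pi, fourierSum (fun m => wt m • F₁ m) n τ ^ (2 * p)
          * fourierSum (fun m => wt m • F m) n τ * exp (-(I * m * τ))
      = ε * lap d (wt m • F m) n) ↔ spectralOp p (branchParams ε ω F₁, σ) F = 0 := by
    rw [spectralOp, branchParams, kgOp_eq_zero_iff hεc hθ]
    refine forall_congr' fun m => ?_
    have hcomp : ∀ n, ((1 + (ε * σ + I * m * ω) ^ 2) • wt m • F m
        + (ε : ℂ) • (((1 + 2 * p : ℂ) • fourierMul F₁ ^ (2 * p)) (unweight F)) m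
        - (ε : ℂ) • lap d (wt m • F m)) n
        = (1 + (ε * σ + I * m * ω) ^ 2) * (wt m • F m) n
        + ε * ((1 + 2 * p) * (fourierMul F₁ ^ (2 * p)) (unweight F) m n)
        - ε * lap d (wt m • F m) n := fun n => rfl
    have hint : ∀ n, (ε : ℂ) * (1 + 2 * p) / (2 * Real.pi) *
        ∫ τ in (-Real.pi)..Real.pi, fourierSum (fun m => wt m • F₁ m) n τ ^ (2 * p)
          * fourierSum (fun m => wt m • F m) n τ * exp (-(I * m * τ))
        = ε * ((1 + 2 * p) * (fourierMul F₁ ^ (2 * p)) (unweight F) m n) := fun n => by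
      rw [integral_fourierSum_pow_mul]
      field_simp
    constructor
    · intro h
      refine lp.ext (funext fun n => ?_)
      rw [hcomp, ← hint, h n, sub_self]
      rfl
    · intro h n
      have h' := hcomp n
      rw [h, ← hint] at h'
      exact (sub_eq_zero.mp h'.symm)
  refine ⟨fun h => ⟨hne.mp h.ne_zero, heq.mp h.eqn⟩, fun h => ⟨memL22_wt_smul F, hne.mpr h.1, ?_⟩⟩
  exact heq.mpr h.2

/-- The conjugate of (εσ + imω)² is (-εσ̄ + imω)², so conjugation without reflecting m replaces σ by
-σ̄. -/
theorem spectralOp_star {p : ℕ} {ε ω : ℝ} (hε : ε ≠ 0) {F₁ F : Modes d} (hF₁ : star F₁ = F₁)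
    {σ : ℂ} (h : spectralOp p (branchParams ε ω F₁, σ) F = 0) :
    spectralOp p (branchParams ε ω F₁, -star σ) (star F) = 0 := by
  have hεc : (ε : ℂ) ≠ 0 := by exact_mod_cast hε
  have hθ : (ε : ℂ) * (((1 - ω ^ 2) / ε : ℝ) : ℂ) = 1 - (ω : ℂ) ^ 2 := by
    push_cast
    field_simp
  rw [spectralOp, branchParams, kgOp_eq_zero_iff hεc hθ] at h ⊢
  intro m
  have h' := congrArg star (h m)
  have hsymb : star (1 + (ε * σ + I * m * ω) ^ 2) = 1 + (ε * -star σ + I * m * ω) ^ 2 := by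
    simp
    ring
  have hV : star ((((1 + 2 * p : ℂ) • fourierMul F₁ ^ (2 * p)) (unweight F)) m)
      = (((1 + 2 * p : ℂ) • fourierMul F₁ ^ (2 * p)) (unweight (star F))) m := by
    rw [smul_apply, smul_apply, unweight_star]
    conv_rhs => rw [← hF₁]
    rw [fourierMul_pow_star, lp.coeFn_smul, lp.coeFn_smul, Pi.smul_apply, Pi.smul_apply,
      lp.star_apply, star_smul]
    simp
  have hεs : star (ε : ℂ) = ε := by simp
  rw [star_sub, star_add, star_smul, star_smul, star_smul, star_smul, ← lap_star, star_smul,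
    hsymb, hV, star_wt, hεs, star_zero] at h'
  exact h'

/-- The branch estimate covers the modes m ≥ 0 only; evenness extends it to the full ℓ¹ norm. -/
theorem tsum_int_le_of_even {f : ℤ → ℝ} (hf : Summable f) (h0 : ∀ m, 0 ≤ f m)
    (heven : ∀ m, f (-m) = f m) :
    ∑' m, f m ≤ 2 * (f 0 + f 1 + ∑' m : ℕ, f (m + 2)) := by
  have hnat : Summable fun m : ℕ => f m := hf.comp_injective Nat.cast_injective
  have hnat1 : Summable fun m : ℕ => f (m + 1) := by
    simpa using (summable_nat_add_iff 1).mpr hnat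
  have hneg : Summable fun m : ℕ => f (-((m : ℤ) + 1)) := by
    simpa only [heven] using hnat1
  rw [tsum_of_nat_of_neg_add_one hnat hneg]
  simp only [heven]
  have e1 : ∑' m : ℕ, f m = f 0 + ∑' m : ℕ, f (m + 1) := by
    simpa using hnat.tsum_eq_zero_add
  have e2 : ∑' m : ℕ, f (m + 1) = f 1 + ∑' m : ℕ, f (m + 2) := by
    have := hnat1.tsum_eq_zero_add
    simpa [add_assoc, one_add_one_eq_two] using this
  rw [e1, e2]
  linarith [h0 0]

/-- For a given branch, analyticity at ε = 0 is not available. Treating θ and the multiplication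
operator as independent parameters means that this O(ε) estimate is enough. -/
theorem IsBreatherBranch.norm_branchParams_sub_le {p : ℕ} {Ω : ℝ} {a : Latt d} {ε₁ C₁ : ℝ}
    {ω : ℝ → ℝ} {A : ℝ → ℤ → Latt d} (h : IsBreatherBranch p Ω a ε₁ C₁ ω A) :
    ∃ C, 0 ≤ C ∧ ∀ ε ∈ Set.Ioo 0 ε₁, ε ≤ 1 → ∀ F : Modes d, (∀ m, A ε m = wt m • F m) →
      ‖branchParams ε (ω ε) F - baseParams Ω a‖ ≤ C * ε := by
  set C₂ : ℝ := |Ω| / 2 + |C₁| with hC₂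
  have hC₂0 : 0 ≤ C₂ := by positivity
  refine ⟨1 + C₂ + (2 * |C₁| + C₂ ^ 2) + 2 * |C₁|, by positivity, fun ε hε hε1 F hF => ?_⟩
  have hε0 : 0 < ε := hε.1
  have hC1 : C₁ ≤ |C₁| := le_abs_self _
  have hδ : |ω ε - 1 + ε * Ω / 2| ≤ |C₁| * ε ^ 2 :=
    (h.bound_freq ε hε).trans (mul_le_mul_of_nonneg_right hC1 (sq_nonneg _))
  have hεΩ : |ε * Ω / 2| = |Ω| / 2 * ε := by
    rw [abs_div, abs_mul, abs_of_pos hε0, abs_of_pos (two_pos : (0 : ℝ) < 2)]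
    ring
  have hω1 : |ω ε - 1| ≤ C₂ * ε := by
    have h1 : |ω ε - 1| ≤ |ω ε - 1 + ε * Ω / 2| + |ε * Ω / 2| := by
      have := abs_sub (ω ε - 1 + ε * Ω / 2) (ε * Ω / 2)
      rwa [add_sub_cancel_right] at this
    have h2 : |C₁| * ε ^ 2 ≤ |C₁| * ε :=
      mul_le_mul_of_nonneg_left (by nlinarith) (abs_nonneg _)
    rw [hC₂, add_mul]
    linarith
  have hθ : |(1 - ω ε ^ 2) / ε - Ω| ≤ (2 * |C₁| + C₂ ^ 2) * ε := by
    -- Uses 1 - ω² = -2(ω - 1) - (ω - 1)²; the frequency bound to second order is what makes the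
    -- quotient by ε small.
    have e1 : (1 - ω ε ^ 2) / ε - Ω
        = -(2 * (ω ε - 1 + ε * Ω / 2) + (ω ε - 1) ^ 2) / ε := by
      field_simp
      ring
    rw [e1, abs_div, abs_neg, abs_of_pos hε0, div_le_iff₀ hε0]
    refine (abs_add_le _ _).trans ?_
    have h3 : (ω ε - 1) ^ 2 ≤ (C₂ * ε) ^ 2 := by
      rw [← sq_abs]
      exact pow_le_pow_left₀ (abs_nonneg _) hω1 2
    rw [abs_mul, abs_of_pos (two_pos : (0 : ℝ) < 2), abs_of_nonneg (sq_nonneg (ω ε - 1))]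
    nlinarith
  have hM : ‖fourierMul F - fourierMul ((2 : ℂ) • pairIn (a, a))‖ ≤ 2 * |C₁| * ε := by
    set G : Modes d := F - (2 : ℂ) • pairIn (a, a) with hG
    have hGm : ∀ m, wt m • G m = A ε m - pairIn (a, a) m := fun m => by
      rw [hG, lp.coeFn_sub, Pi.sub_apply, smul_sub, ← hF, ← unweight_apply ((2 : ℂ) • _),
        unweight_two_smul_pairIn]
    rw [← map_sub]
    refine (norm_fourierMul_le G).trans ?_
    refine (tsum_int_le_of_even (summable_norm_wt_smul G) (fun _ => norm_nonneg _)
      fun m => ?_).trans ?_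
    · rw [hGm, hGm, (h.breather ε hε).even, ← reflect_apply (pairIn (a, a)) m, pairIn_reflect]
    · have e0 : wt 0 • G 0 = A ε 0 := by rw [hGm, pairIn_far _ (by norm_num), sub_zero]
      have e1 : wt 1 • G 1 = A ε 1 - a := by rw [hGm, pairIn_one]
      have e2 : ∀ m : ℕ, wt ((m : ℤ) + 2) • G ((m : ℤ) + 2) = A ε (m + 2) := fun m => by
        rw [hGm, pairIn_far _ (by omega), sub_zero]
      simp_rw [e0, e1, e2]
      have h4 := h.bound_coeff ε hε
      have h5 : C₁ * ε ≤ |C₁| * ε := mul_le_mul_of_nonneg_right hC1 hε0.le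
      linarith
  have k1 : ‖(ε : ℂ) - 0‖ = ε := by rw [sub_zero, norm_real, Real.norm_of_nonneg hε0.le]
  have k2 : ‖(ω ε : ℂ) - 1‖ = |ω ε - 1| := by
    rw [← ofReal_one, ← ofReal_sub, norm_real, Real.norm_eq_abs]
  have k3 : ‖(((1 - ω ε ^ 2) / ε : ℝ) : ℂ) - (Ω : ℂ)‖ = |(1 - ω ε ^ 2) / ε - Ω| := by
    rw [← ofReal_sub, norm_real, Real.norm_eq_abs]
  have p1 : 0 ≤ C₂ * ε := by positivity
  have p2 : 0 ≤ (2 * |C₁| + C₂ ^ 2) * ε := by positivity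
  have p3 : 0 ≤ 2 * |C₁| * ε := by positivity
  change ‖((ε : ℂ) - 0, (ω ε : ℂ) - 1, (((1 - ω ε ^ 2) / ε : ℝ) : ℂ) - (Ω : ℂ),
    fourierMul F - fourierMul ((2 : ℂ) • pairIn (a, a)))‖ ≤ _
  rw [Prod.norm_mk, Prod.norm_mk, Prod.norm_mk, k1, k2, k3]
  refine max_le ?_ (max_le ?_ (max_le ?_ ?_)) <;> linarith

/-- With 2Λ = is, the condition s ∈ [Ω, Ω + 4d] is Ω - s ∈ [-4d, 0], and -s ∈ [Ω, Ω + 4d] is Ω + s ∈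
[-4d, 0]. -/
theorem not_mem_Icc_of_not_mem_contSpec {Ω : ℝ} {Λ : ℂ} (hre : Λ.re = 0)
    (hΛ : 2 * Λ ∉ contSpec d Ω) :
    Ω - 2 * Λ.im ∉ Set.Icc (-(4 * d : ℝ)) 0 ∧ Ω + 2 * Λ.im ∉ Set.Icc (-(4 * d : ℝ)) 0 := by
  have hΛ' : 2 * Λ = I * ((2 * Λ.im : ℝ) : ℂ) := by
    apply Complex.ext <;> simp [hre]
  refine ⟨fun h => hΛ ⟨2 * Λ.im, ⟨?_, ?_⟩, Or.inl hΛ'⟩,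
    fun h => hΛ ⟨-(2 * Λ.im), ⟨?_, ?_⟩, Or.inr ?_⟩⟩
  · linarith [h.2]
  · linarith [h.1]
  · linarith [h.2]
  · linarith [h.1]
  · rw [hΛ', ofReal_neg]
    ring

/-! ### The eigenpair branch: construction, estimates, imaginary eigenvalue, uniqueness. -/

theorem exists_eigenpair_near_base {p : ℕ} (hp : 1 ≤ p) {Ω : ℝ} {a : Latt d}
    (ha : ∀ n, (a n).im = 0) {Λ : ℂ} (hre : Λ.re = 0)
    (hΛ : IsSimpleIsolatedEigenvalue (linNLS p Ω a) (2 * Λ)) (hΛc : 2 * Λ ∉ contSpec d Ω)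
    {b : Latt d × Latt d} (hb0 : b ≠ 0) (hb : linNLS p Ω a b = (2 * Λ) • b) :
    ∃ (s : Params d → ℂ) (ψ : Params d → Modes d), AnalyticAt ℂ s (baseParams Ω a) ∧
      AnalyticAt ℂ ψ (baseParams Ω a) ∧ s (baseParams Ω a) = Λ ∧
      ψ (baseParams Ω a) = (2 : ℂ) • pairIn (polarize b) ∧
      (∀ᶠ q in 𝓝 (baseParams Ω a), spectralOp p (q, s q) (ψ q) = 0 ∧ ψ q ≠ 0) ∧
      ∀ᶠ v in 𝓝 (baseParams Ω a, Λ), ∀ F, F ≠ 0 → spectralOp p v F = 0 →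
        v.2 = s v.1 ∧ ∃ c : ℂ, F = c • ψ v.1 := by
  -- Hahn–Banach supplies a functional normalised on the limit eigenvector.
  obtain ⟨ℓ, hℓ⟩ := SeparatingDual.exists_eq_one (R := ℂ) (polarize_ne_zero hb0)
  obtain ⟨h1, h2⟩ := not_mem_Icc_of_not_mem_contSpec hre hΛc
  refine exists_analytic_eigenpair (ℓ := ℓ.comp pairOut) (r := pairIn (copolarize b))
    (analyticAt_spectralOp p _) ?_ (fun σ => ?_) ?_
  · rw [ContinuousLinearMap.comp_apply, pairOut_two_smul_pairIn, hℓ]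
  · rw [spectralOp_base, baseOp_pairIn hp Ω ha, pairOp_polarize, hb, ← sub_smul, ← mul_sub,
      ← map_smul]
    have := copolarize_add_smul (2 * (Λ - σ)) 0 b
    have h0 : copolarize (0 : Latt d × Latt d) = 0 := by simp [copolarize]
    rw [h0, zero_add, zero_add] at this
    rw [this]
  · have hbij := bijective_baseOp_add hp ha hre h1 h2
      (isCompactOperator_smulRight ℓ (copolarize b))
      (pairOp_add_smulRight_injective hΛ hb0 hb hℓ)
    have hop : pairIn.comp ((ℓ.smulRight (copolarize b)).comp pairOut)
        = (ℓ.comp pairOut).smulRight (pairIn (copolarize b)) := by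
      ext1 F
      exact map_smul pairIn _ _
    rw [hop] at hbij
    exact hbij

theorem norm_coeff_sub_add_le (G : Modes d) :
    ‖wt 1 • G 1‖ + ‖wt (-1) • G (-1)‖ ≤ 2 * ‖G‖ := by
  linarith [norm_wt_smul_le G 1, norm_wt_smul_le G (-1)]

theorem norm_coeff_far_le (G : Modes d) :
    ‖wt 0 • G 0‖ + ∑' m : ℕ, (‖wt (m + 2) • G (m + 2)‖ + ‖wt (-(m + 2)) • G (-(m + 2))‖)
      ≤ (1 + 2 * wtSum) * ‖G‖ := by
  have hs := summable_norm_wt_smul G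
  have hinj : Function.Injective fun m : ℕ => (m : ℤ) + 2 := fun _ _ h => by simpa using h
  have hinj' : Function.Injective fun m : ℕ => -((m : ℤ) + 2) := fun _ _ h => by simpa using h
  have hs1 : Summable fun m : ℕ => ‖wt ((m : ℤ) + 2) • G ((m : ℤ) + 2)‖ := hs.comp_injective hinj
  have hs2 : Summable fun m : ℕ => ‖wt (-((m : ℤ) + 2)) • G (-((m : ℤ) + 2))‖ :=
    hs.comp_injective hinj'
  rw [hs1.tsum_add hs2]
  have h1 := tsum_norm_wt_shift_le G
  have h2 : ∑' m : ℕ, ‖wt (-((m : ℤ) + 2)) • G (-((m : ℤ) + 2))‖ ≤ wtSum * ‖G‖ :=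
    (tsum_comp_le_tsum_of_inj hs (fun _ => norm_nonneg _) hinj').trans (tsum_norm_wt_smul_le G)
  linarith [norm_wt_smul_le G 0]

set_option maxHeartbeats 1000000 in
theorem exists_eigenpair_branch {p : ℕ} (hp : 1 ≤ p) {Ω : ℝ} {a : Latt d}
    (ha : ∀ n, (a n).im = 0) {Λ : ℂ} (hre : Λ.re = 0)
    (hΛ : IsSimpleIsolatedEigenvalue (linNLS p Ω a) (2 * Λ)) (hΛc : 2 * Λ ∉ contSpec d Ω)
    {bp bm : Latt d} (hb0 : (bp, bm) ≠ 0) (hb : linNLS p Ω a (bp, bm) = (2 * Λ) • (bp, bm))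
    {ε₁ C₁ : ℝ} {ω : ℝ → ℝ} {A : ℝ → ℤ → Latt d} (h : IsBreatherBranch p Ω a ε₁ C₁ ω A) :
    ∃ ε₀ C₀ δ : ℝ, 0 < ε₀ ∧ ε₀ ≤ ε₁ ∧ 0 < C₀ ∧ 0 < δ ∧ C₀ * ε₀ ≤ δ ∧
      ∃ (lam : ℝ → ℂ) (B : ℝ → ℤ → Latt d),
        AnalyticOnNhd ℝ lam (Set.Ioo 0 ε₀) ∧
        AnalyticL22On B (Set.Ioo 0 ε₀) ∧
        ∀ ε ∈ Set.Ioo 0 ε₀,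
          IsEigenpair p ε (ω ε) (A ε) (lam ε) (B ε) ∧
          (lam ε).re = 0 ∧
          ‖lam ε - ε * Λ‖ ≤ C₀ * ε ^ 2 ∧
          ‖B ε 1 - bp - Complex.I • bm‖ + ‖B ε (-1) - bp + Complex.I • bm‖ ≤ C₀ * ε ∧
          ‖B ε 0‖ + ∑' m : ℕ, (‖B ε (m + 2)‖ + ‖B ε (-(m + 2))‖) ≤ C₀ * ε ∧
          ∀ (μ : ℂ) (B' : ℤ → Latt d), IsEigenpair p ε (ω ε) (A ε) μ B' →
            ‖μ - ε * Λ‖ < δ * ε → μ = lam ε ∧ ∃ c : ℂ, B' = c • B ε := by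
  obtain ⟨s, ψ, hs, hψ, hs0, hψ0, hsol, huniq⟩ :=
    exists_eigenpair_near_base hp ha hre hΛ hΛc hb0 hb
  obtain ⟨F₁, hF₁an, hF₁w⟩ := h.analytic_coeff
  have hF₁ : ∀ ε ∈ Set.Ioo 0 ε₁, ∀ m, A ε m = wt m • F₁ ε m := fun ε hε m => by
    rw [hF₁w ε hε m, weighted, smul_smul, wt, inv_mul_cancel₀ (one_add_sq_ne_zero m), one_smul]
  have hF₁star : ∀ ε ∈ Set.Ioo 0 ε₁, star (F₁ ε) = F₁ ε := fun ε hε => by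
    refine Modes.ext' fun m n => ?_
    have h1 : F₁ ε m n = (1 + (m : ℂ) ^ 2) * A ε m n := by
      rw [hF₁w ε hε m]
      rfl
    have h2 : star (A ε m n) = A ε m n := conj_eq_iff_im.mpr ((h.breather ε hε).real m n)
    rw [lp.star_apply, lp.star_apply, h1, star_mul', h2]
    simp
  obtain ⟨C, hC0, hC⟩ := h.norm_branchParams_sub_le
  obtain ⟨Cs, hCs0, hCs⟩ := hs.differentiableAt.isBigO_sub.exists_pos
  obtain ⟨Cψ, hCψ0, hCψ⟩ := hψ.differentiableAt.isBigO_sub.exists_pos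
  obtain ⟨ρ, hρ, hball⟩ := Metric.eventually_nhds_iff.mp
    ((hCs.bound.and hCψ.bound).and
      ((hs.eventually_analyticAt.and hψ.eventually_analyticAt).and hsol))
  obtain ⟨δ, hδ, huball⟩ := Metric.eventually_nhds_iff.mp huniq
  rw [hs0, hψ0] at hball
  set F₀ : Modes d := (2 : ℂ) • pairIn (polarize (bp, bm)) with hF₀
  have hw0 := wtSum_nonneg
  set C₀ : ℝ := C * Cs + (2 + 2 * wtSum) * (Cψ * C) + 1 with hC₀
  have hC₀pos : 0 < C₀ := by positivity
  -- Keeps the branch parameters inside both neighbourhoods; C + 1 replaces C, which may be zero.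
  set η : ℝ := min ρ δ / (C + 1) with hη
  have hη0 : 0 < η := by positivity
  set ε₀ : ℝ := min (min ε₁ 1) (min η (δ / C₀)) with hε₀
  have hε₀0 : 0 < ε₀ := lt_min (lt_min h.pos one_pos) (lt_min hη0 (by positivity))
  have hε₀1 : ε₀ ≤ ε₁ := (min_le_left _ _).trans (min_le_left _ _)
  have hε₀2 : ε₀ ≤ 1 := (min_le_left _ _).trans (min_le_right _ _)
  have hε₀3 : ε₀ ≤ η := (min_le_right _ _).trans (min_le_left _ _)
  have hε₀4 : ε₀ ≤ δ / C₀ := (min_le_right _ _).trans (min_le_right _ _)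
  have hC₀δ : C₀ * ε₀ ≤ δ := by
    rw [mul_comm]
    exact (le_div_iff₀ hC₀pos).mp hε₀4
  let π : ℝ → Params d := fun ε => branchParams ε (ω ε) (F₁ ε)
  have hIoo : ∀ ε ∈ Set.Ioo 0 ε₀, ε ∈ Set.Ioo 0 ε₁ := fun ε hε => ⟨hε.1, hε.2.trans_le hε₀1⟩
  have hπ : ∀ ε ∈ Set.Ioo 0 ε₀, ‖π ε - baseParams Ω a‖ ≤ C * ε := fun ε hε =>
    hC ε (hIoo ε hε) (hε.2.le.trans hε₀2) (F₁ ε) (hF₁ ε (hIoo ε hε))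
  have hπlt : ∀ ε ∈ Set.Ioo 0 ε₀, ‖π ε - baseParams Ω a‖ < min ρ δ := fun ε hε => by
    refine (hπ ε hε).trans_lt ?_
    have h1 : (C + 1) * η = min ρ δ := by
      rw [hη]
      field_simp
    have h2 : ε < η := hε.2.trans_le hε₀3
    rw [← h1]
    exact (mul_le_mul_of_nonneg_right (by linarith) hε.1.le).trans_lt
      (mul_lt_mul_of_pos_left h2 (by linarith))
  have hgood := fun ε hε => hball (y := π ε) (by
    rw [dist_eq_norm]
    exact (hπlt ε hε).trans_le (min_le_left _ _))
  have hπan : ∀ ε ∈ Set.Ioo 0 ε₀, AnalyticAt ℝ π ε := fun ε hε => by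
    have h1 : AnalyticAt ℝ ω ε := h.analytic_freq ε (hIoo ε hε)
    have h2 : AnalyticAt ℝ (fun x => (1 - ω x ^ 2) / x) ε :=
      (analyticAt_const.sub (h1.pow 2)).div analyticAt_id hε.1.ne'
    have h3 : AnalyticAt ℝ (fun x => fourierMul (F₁ x)) ε :=
      (((fourierMul (d := d)).analyticAt (F₁ ε)).restrictScalars (𝕜 := ℝ)).comp
        (hF₁an ε (hIoo ε hε))
    exact (Complex.ofRealCLM.analyticAt ε).prod (((Complex.ofRealCLM.analyticAt _).comp h1).prod
      (((Complex.ofRealCLM.analyticAt _).comp h2).prod h3))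
  have hσb : ∀ ε ∈ Set.Ioo 0 ε₀, ‖s (π ε) - Λ‖ ≤ C * Cs * ε := fun ε hε => by
    rw [mul_comm C, mul_assoc]
    exact (hgood ε hε).1.1.trans (mul_le_mul_of_nonneg_left (hπ ε hε) hCs0.le)
  have hσlt : ∀ ε ∈ Set.Ioo 0 ε₀, ‖s (π ε) - Λ‖ < δ := fun ε hε => by
    refine (hσb ε hε).trans_lt (lt_of_lt_of_le ?_ hC₀δ)
    have h1 : C * Cs ≤ C₀ := by
      have : 0 ≤ (2 + 2 * wtSum) * (Cψ * C) := by positivity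
      linarith
    exact (mul_le_mul_of_nonneg_right h1 hε.1.le).trans_lt (mul_lt_mul_of_pos_left hε.2 hC₀pos)
  have hU : ∀ ε ∈ Set.Ioo 0 ε₀, ∀ σ : ℂ, ‖σ - Λ‖ < δ → ∀ F, F ≠ 0 →
      spectralOp p (π ε, σ) F = 0 → σ = s (π ε) ∧ ∃ c : ℂ, F = c • ψ (π ε) := fun ε hε σ hσ => by
    refine huball (y := (π ε, σ)) ?_
    rw [Prod.dist_eq, dist_eq_norm, dist_eq_norm]
    exact max_lt ((hπlt ε hε).trans_le (min_le_right _ _)) hσ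
  have hAeq : ∀ ε ∈ Set.Ioo 0 ε₀, A ε = fun m => wt m • F₁ ε m := fun ε hε =>
    funext (hF₁ ε (hIoo ε hε))
  refine ⟨ε₀, C₀, δ, hε₀0, hε₀1, hC₀pos, hδ, hC₀δ, fun ε => ε * s (π ε),
    fun ε m => wt m • ψ (π ε) m, ?_, ?_, ?_⟩
  · intro ε hε
    exact (Complex.ofRealCLM.analyticAt ε).mul
      (((hgood ε hε).2.1.1.restrictScalars (𝕜 := ℝ)).comp (hπan ε hε))
  · refine ⟨fun ε => ψ (π ε), fun ε hε => ?_, fun ε _ m => (weighted_wt_smul _ m).symm⟩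
    exact ((hgood ε hε).2.1.2.restrictScalars (𝕜 := ℝ)).comp (hπan ε hε)
  · intro ε hε
    obtain ⟨⟨hb1, hb2⟩, -, hker, hne⟩ := hgood ε hε
    have hε0 : 0 < ε := hε.1
    have hεc : (ε : ℂ) ≠ 0 := by exact_mod_cast hε0.ne'
    set G : Modes d := ψ (π ε) - F₀ with hG
    have hGb : ‖G‖ ≤ Cψ * C * ε := by
      rw [mul_assoc]
      exact hb2.trans (mul_le_mul_of_nonneg_left (hπ ε hε) hCψ0.le)
    have hGm : ∀ m : ℤ, wt m • G m = wt m • ψ (π ε) m - pairIn (polarize (bp, bm)) m := fun m => by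
      rw [hG, lp.coeFn_sub, Pi.sub_apply, smul_sub, hF₀, ← unweight_apply ((2 : ℂ) • _),
        unweight_two_smul_pairIn]
    have hGfar : ∀ m : ℤ, ¬(m = 1 ∨ m = -1) → wt m • ψ (π ε) m = wt m • G m := fun m hm => by
      rw [hGm, pairIn_far _ hm, sub_zero]
    have hG1 : wt 1 • ψ (π ε) 1 - bp - I • bm = wt 1 • G 1 := by
      rw [hGm, pairIn_one, polarize, sub_sub]
    have hGn1 : wt (-1) • ψ (π ε) (-1) - bp + I • bm = wt (-1) • G (-1) := by
      rw [hGm, pairIn_neg_one, polarize, sub_add]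
    have hCψC : 0 ≤ Cψ * C := by positivity
    have hCCs : 0 ≤ C * Cs := by positivity
    refine ⟨?_, ?_, ?_, ?_, ?_, ?_⟩
    · rw [hAeq ε hε]
      exact (isEigenpair_iff hε0.ne').mpr ⟨hne, hker⟩
    -- Since Λ = -Λ̄, the number -σ̄ is as close to Λ as σ is; uniqueness gives σ = -σ̄.
    · have hstar := spectralOp_star hε0.ne' (hF₁star ε (hIoo ε hε)) hker
      have hΛs : star Λ = -Λ := by
        apply Complex.ext <;> simp [hre]
      have hnorm : ‖-star (s (π ε)) - Λ‖ < δ := by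
        have : -star (s (π ε)) - Λ = -star (s (π ε) - Λ) := by
          rw [star_sub, hΛs]
          ring
        rw [this, norm_neg, norm_star]
        exact hσlt ε hε
      have hσ := (hU ε hε _ hnorm _ (star_ne_zero.mpr hne) hstar).1
      have hre0 : (s (π ε)).re = 0 := by
        have := congrArg Complex.re hσ
        simp at this
        linarith
      simp [hre0]
    · rw [← mul_sub, norm_mul, norm_real, Real.norm_of_nonneg hε0.le]
      have h1 : ε * ‖s (π ε) - Λ‖ ≤ ε * (C * Cs * ε) :=
        mul_le_mul_of_nonneg_left (hσb ε hε) hε0.le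
      have h2 : C * Cs * ε ^ 2 ≤ C₀ * ε ^ 2 := by
        refine mul_le_mul_of_nonneg_right ?_ (sq_nonneg _)
        have : 0 ≤ (2 + 2 * wtSum) * (Cψ * C) := by positivity
        linarith
      calc _ ≤ _ := h1
        _ = C * Cs * ε ^ 2 := by ring
        _ ≤ _ := h2
    · rw [hG1, hGn1]
      refine (norm_coeff_sub_add_le G).trans ?_
      have h1 : 2 * (Cψ * C) ≤ C₀ := by
        have : 0 ≤ wtSum * (Cψ * C) := by positivity
        linarith
      calc 2 * ‖G‖ ≤ 2 * (Cψ * C * ε) := by linarith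
        _ = 2 * (Cψ * C) * ε := by ring
        _ ≤ C₀ * ε := mul_le_mul_of_nonneg_right h1 hε0.le
    · have e2 : ∀ m : ℕ, wt ((m : ℤ) + 2) • ψ (π ε) ((m : ℤ) + 2)
          = wt ((m : ℤ) + 2) • G ((m : ℤ) + 2) := fun m => hGfar _ (by omega)
      have e3 : ∀ m : ℕ, wt (-((m : ℤ) + 2)) • ψ (π ε) (-((m : ℤ) + 2))
          = wt (-((m : ℤ) + 2)) • G (-((m : ℤ) + 2)) := fun m => hGfar _ (by omega)
      simp_rw [hGfar 0 (by norm_num), e2, e3]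
      refine (norm_coeff_far_le G).trans ?_
      have h1 : (1 + 2 * wtSum) * (Cψ * C) ≤ C₀ := by linarith
      calc (1 + 2 * wtSum) * ‖G‖ ≤ (1 + 2 * wtSum) * (Cψ * C * ε) :=
            mul_le_mul_of_nonneg_left hGb (by linarith)
        _ = (1 + 2 * wtSum) * (Cψ * C) * ε := by ring
        _ ≤ C₀ * ε := mul_le_mul_of_nonneg_right h1 hε0.le
    · intro μ B' hB' hμ
      -- A competitor is transported to the weighted variables and the scaled eigenvalue μ/ε, where
      -- the local uniqueness statement applies.
      let F : Modes d := ⟨weighted B', hB'.mem⟩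
      have hBF : B' = fun m => wt m • F m := funext fun m => by
        change B' m = wt m • ((1 + (m : ℂ) ^ 2) • B' m)
        rw [smul_smul, wt, inv_mul_cancel₀ (one_add_sq_ne_zero m), one_smul]
      have hμσ : μ = ε * (μ / ε) := by field_simp
      rw [hAeq ε hε, hBF, hμσ] at hB'
      obtain ⟨hF0, hFk⟩ := (isEigenpair_iff hε0.ne').mp hB'
      have hlt : ‖μ / ε - Λ‖ < δ := by
        have e1 : μ / ε - Λ = (μ - ε * Λ) / ε := by field_simp
        rw [e1, norm_div, norm_real, Real.norm_of_nonneg hε0.le, div_lt_iff₀ hε0]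
        exact hμ
      obtain ⟨hσ, c, hc⟩ := hU ε hε _ hlt F hF0 hFk
      refine ⟨?_, c, ?_⟩
      · exact hμσ.trans (congrArg (fun z => (ε : ℂ) * z) hσ)
      · rw [hBF]
        funext m
        rw [hc]
        exact smul_comm (wt m) c (ψ (π ε) m)

end

end KleinGordon

open KleinGordon in
theorem theorem3 (d p : ℕ) (hd : 1 ≤ d) (hp : 1 ≤ p)
    (Ω : ℝ) (hΩ : Ω ∉ Set.Icc (-(4 * d : ℝ)) 0)
    (a : Latt d) (ha : IsSoliton p Ω a)
    (hJ : ∀ v : Latt d, jac p Ω a v = 0 → v = 0)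
    (Λ : ℂ) (hΛim : Λ.re = 0) (hΛ0 : Λ ≠ 0)
    (hΛ : IsSimpleIsolatedEigenvalue (linNLS p Ω a) (2 * Λ))
    (hΛc : 2 * Λ ∉ contSpec d Ω)
    (bp bm : Latt d) (hb0 : (bp, bm) ≠ 0)
    (hb : linNLS p Ω a (bp, bm) = (2 * Λ) • (bp, bm)) :
    (∃ (ε₁ C₁ : ℝ) (ω : ℝ → ℝ) (A : ℝ → ℤ → Latt d), IsBreatherBranch p Ω a ε₁ C₁ ω A) ∧
    ∀ (ε₁ C₁ : ℝ) (ω : ℝ → ℝ) (A : ℝ → ℤ → Latt d), IsBreatherBranch p Ω a ε₁ C₁ ω A →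
      ∃ ε₀ C₀ δ : ℝ, 0 < ε₀ ∧ ε₀ ≤ ε₁ ∧ 0 < C₀ ∧ 0 < δ ∧ C₀ * ε₀ ≤ δ ∧
        ∃ (lam : ℝ → ℂ) (B : ℝ → ℤ → Latt d),
          AnalyticOnNhd ℝ lam (Set.Ioo 0 ε₀) ∧
          AnalyticL22On B (Set.Ioo 0 ε₀) ∧
          ∀ ε ∈ Set.Ioo 0 ε₀,
            IsEigenpair p ε (ω ε) (A ε) (lam ε) (B ε) ∧
            (lam ε).re = 0 ∧
            ‖lam ε - ε * Λ‖ ≤ C₀ * ε ^ 2 ∧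
            ‖B ε 1 - bp - Complex.I • bm‖ + ‖B ε (-1) - bp + Complex.I • bm‖ ≤ C₀ * ε ∧
            ‖B ε 0‖ + ∑' m : ℕ, (‖B ε (m + 2)‖ + ‖B ε (-(m + 2))‖) ≤ C₀ * ε ∧
            ∀ (μ : ℂ) (B' : ℤ → Latt d), IsEigenpair p ε (ω ε) (A ε) μ B' →
              ‖μ - ε * Λ‖ < δ * ε → μ = lam ε ∧ ∃ c : ℂ, B' = c • B ε :=
  ⟨exists_breatherBranch hp hΩ ha hJ, fun _ _ _ _ h =>
    exists_eigenpair_branch hp ha.1 hΛim hΛ hΛc hb0 hb h⟩
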